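/- Let $g$ be a smooth Riemannian metric on $\mathbb R^3$ that is asymptotically Schwarzschild of mass $m>0$: in the standard coordinates, outside some ball, $$g_{ij}=\Bigl(1+\frac{m}{2r}\Bigr)^4\delta_{ij}+p_{ij},\qquad p_{ij}=O_4(r^{-2}),\qquad r=|x|,$$ where $\phi=O_k(r^{a})$ means that, for some constant $C$, $|\partial^{(i)}\phi|\le C r^{a-i}$ near infinity for all $0\le i\le k$. Put $h_{ij}=g_{ij}-\delta_{ij}$ and, for $\alpha=1,2,3$ and $r>0$ (summing over the repeated indices $i,j$), $$c^\alpha_{\rm CS}(r)=\frac1{16\pi m}\int_{|x|=r}\Bigl[x^\alpha\,(g_{ij,i}-g_{ii,j})\,\nu_g^j-\bigl(h_{i\alpha}\nu_g^i-h_{ii}\nu_g^\alpha\bigr)\Bigr]\,d\sigma_g,$$ where $\nu_g$ is the outward unit normal of the sphere $\{|x|=r\}$ with respect to $g$ and $d\sigma_g$ is its area element induced by $g$. Theorem. The Corvino–Schoen center of mass $\mathbf c_{\rm CS}=\lim_{r\to\infty}\bigl(c^1_{\rm CS}(r),c^2_{\rm CS}(r),c^3_{\rm CS}(r)\bigr)$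 exists in $\mathbb R^3$ if and only if, for each $\alpha=1,2,3$, the limit $$\lim_{r\to\infty}\int_{B(r)}x^\alpha R_g\,dv_g$$ exists in $\mathbb R$, where $B(r)=\{|x|<r\}$, $R_g$ is the scalar curvature of $g$ and $dv_g$ its Riemannian volume element. -/

import Mathlib

open Filter Topology MeasureTheory
open scoped ContDiff Matrix

namespace AsymSchwarzschild

/-- Euclidean 3-space, with its standard global coordinates `x 0, x 1, x 2`. -/
abbrev E3 : Type := EuclideanSpace ℝ (Fin 3)

/-- A field of `3 × 3` matrices on `ℝ³`; `g x i j` is the component `g_{ij}(x)`. -/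
abbrev MatrixField : Type := E3 → Matrix (Fin 3) (Fin 3) ℝ

/-- The partial derivative `∂f/∂xⁱ`. -/
noncomputable def pderiv (i : Fin 3) (f : E3 → ℝ) (x : E3) : ℝ :=
  fderiv ℝ f x (EuclideanSpace.single i 1)

/-- `g` is a smooth Riemannian metric on `ℝ³`, written in the standard coordinates
(`Matrix.PosDef` contains the symmetry of `g x`). -/
structure IsRiemannianMetric (g : MatrixField) : Prop where
  smooth : ∀ i j, ContDiff ℝ ∞ (fun x => g x i j)
  posDef : ∀ x, (g x).PosDef

/-- `φ = O_k(r^a)`: for all `0 ≤ i ≤ k`, the `i`-th derivatives of `φ` are bounded by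
`C r^(a - i)` outside some ball. -/
def IsBigOWithDerivs (k : ℕ) (a : ℤ) (φ : E3 → ℝ) : Prop :=
  ∃ R C : ℝ, 0 < R ∧ ∀ i ≤ k, ∀ x : E3, R ≤ ‖x‖ →
    ‖iteratedFDeriv ℝ i φ x‖ ≤ C * ‖x‖ ^ (a - (i : ℤ))

/-- The Schwarzschild metric of mass `m`: `(1 + m / (2 r))⁴ δ_{ij}`. -/
noncomputable def schwarzschild (m : ℝ) : MatrixField :=
  fun x => (1 + m / (2 * ‖x‖)) ^ 4 • (1 : Matrix (Fin 3) (Fin 3) ℝ)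

/-- `g` is a smooth Riemannian metric on `ℝ³` which is asymptotically Schwarzschild of mass
`m > 0`: near infinity `g_{ij} = (1 + m / (2 r))⁴ δ_{ij} + p_{ij}` with `p_{ij} = O_4(r⁻²)`. -/
structure IsAsymptoticallySchwarzschild (g : MatrixField) (m : ℝ) : Prop where
  mass_pos : 0 < m
  metric : IsRiemannianMetric g
  decay : ∀ i j, IsBigOWithDerivs 4 (-2) (fun x => g x i j - schwarzschild m x i j)

/-- The Christoffel symbol
`Γ^k_{ij} = ½ g^{ks} (∂_i g_{js} + ∂_j g_{is} - ∂_s g_{ij})`. -/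
noncomputable def christoffel (g : MatrixField) (k i j : Fin 3) (x : E3) : ℝ :=
  (1 / 2) * ∑ s, (g x)⁻¹ k s *
    (pderiv i (fun y => g y j s) x + pderiv j (fun y => g y i s) x
      - pderiv s (fun y => g y i j) x)

/-- The Ricci tensor
`R_{ij} = ∂_k Γ^k_{ji} - ∂_j Γ^k_{ki} + Γ^k_{kl} Γ^l_{ji} - Γ^k_{jl} Γ^l_{ki}`. -/
noncomputable def ricci (g : MatrixField) (i j : Fin 3) (x : E3) : ℝ :=
  ∑ k, (pderiv k (christoffel g k j i) x - pderiv j (christoffel g k k i) x)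
    + ∑ k, ∑ l, (christoffel g k k l x * christoffel g l j i x
        - christoffel g k j l x * christoffel g l k i x)

/-- The scalar curvature `R_g = g^{ij} R_{ij}`. -/
noncomputable def scalarCurvature (g : MatrixField) (x : E3) : ℝ :=
  ∑ i, ∑ j, (g x)⁻¹ i j * ricci g i j x

/-- The density `√(det g)` of the Riemannian volume `dv_g` with respect to Lebesgue measure. -/
noncomputable def volumeDensity (g : MatrixField) (x : E3) : ℝ :=
  Real.sqrt (g x).det

/-- `∫_{B(r)} x^α R_g dv_g`, over the Euclidean coordinate ball of radius `r` about the origin. -/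
noncomputable def curvatureMoment (g : MatrixField) (α : Fin 3) (r : ℝ) : ℝ :=
  ∫ x in Metric.ball (0 : E3) r, x α * scalarCurvature g x * volumeDensity g x

/-- `g^{ij}(x) x_i x_j`, the squared `g`-length of the covector `x`, which is normal to the
coordinate sphere through `x`. -/
noncomputable def conormSq (g : MatrixField) (x : E3) : ℝ :=
  x.ofLp ⬝ᵥ ((g x)⁻¹ *ᵥ x.ofLp)

/-- The `g`-unit outward normal `ν_g` at `x` of the coordinate sphere `{|y| = |x|}`;
see `unitNormal_unit`, `unitNormal_orthogonal`, `unitNormal_outward`. -/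
noncomputable def unitNormal (g : MatrixField) (x : E3) : Fin 3 → ℝ :=
  (Real.sqrt (conormSq g x))⁻¹ • ((g x)⁻¹ *ᵥ x.ofLp)

/-- The density `dσ_g / dσ_0` at `x` of the area element induced by `g` on the coordinate sphere
`{|y| = |x|}` with respect to the Euclidean one; see `areaDensity_eq`. -/
noncomputable def areaDensity (g : MatrixField) (x : E3) : ℝ :=
  Real.sqrt ((g x).det * conormSq g x) / ‖x‖

/-- `∫_{|x| = r} f dσ_0` for `r > 0`, where `dσ_0` is the Euclidean area element
(`volume.toSphere` is the standard area measure of the unit sphere). -/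
noncomputable def sphereIntegral (f : E3 → ℝ) (r : ℝ) : ℝ :=
  r ^ 2 * ∫ z : Metric.sphere (0 : E3) 1, f (r • (z : E3)) ∂(volume : Measure E3).toSphere

/-- The integrand
`x^α (g_{ij,i} - g_{ii,j}) ν_g^j - (h_{iα} ν_g^i - h_{ii} ν_g^α)`, with `h = g - δ` and
summation over repeated `i`, `j`. -/
noncomputable def csIntegrand (g : MatrixField) (α : Fin 3) (x : E3) : ℝ :=
  x α * (∑ i, ∑ j, (pderiv i (fun y => g y i j) x - pderiv j (fun y => g y i i) x)
      * unitNormal g x j)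
    - (∑ i, (g x - 1) i α * unitNormal g x i - ∑ i, (g x - 1) i i * unitNormal g x α)

/-- The vector `c_CS(r)`, with components
`(16 π m)⁻¹ ∫_{|x| = r} [x^α (g_{ij,i} - g_{ii,j}) ν_g^j - (h_{iα} ν_g^i - h_{ii} ν_g^α)] dσ_g`. -/
noncomputable def csCenter (g : MatrixField) (m r : ℝ) : E3 :=
  WithLp.toLp 2 fun α =>
    1 / (16 * Real.pi * m) * sphereIntegral (fun x => csIntegrand g α x * areaDensity g x) r

/-- The Corvino–Schoen center of mass `c_CS = lim_{r → ∞} c_CS(r)` exists. -/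
def CSCenterExists (g : MatrixField) (m : ℝ) : Prop :=
  ∃ c : E3, Tendsto (fun r : ℝ => csCenter g m r) atTop (𝓝 c)


theorem mulVec_inv_mulVec {g : MatrixField} (hg : IsRiemannianMetric g) (x : E3)
    (v : Fin 3 → ℝ) : g x *ᵥ ((g x)⁻¹ *ᵥ v) = v := by
  rw [Matrix.mulVec_mulVec, Matrix.mul_nonsing_inv _ (hg.posDef x).det_pos.ne'.isUnit,
    Matrix.one_mulVec]

theorem conormSq_pos {g : MatrixField} (hg : IsRiemannianMetric g) {x : E3} (hx : x ≠ 0) :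
    0 < conormSq g x := by
  have h := (hg.posDef x).inv.dotProduct_mulVec_pos (x := x.ofLp) (by simpa using hx)
  simpa [conormSq] using h

theorem mulVec_unitNormal {g : MatrixField} (hg : IsRiemannianMetric g) (x : E3) :
    g x *ᵥ unitNormal g x = (Real.sqrt (conormSq g x))⁻¹ • x.ofLp := by
  rw [unitNormal, Matrix.mulVec_smul, mulVec_inv_mulVec hg]

/-- `g(ν_g, ν_g) = 1`. -/
theorem unitNormal_unit {g : MatrixField} (hg : IsRiemannianMetric g) {x : E3} (hx : x ≠ 0) :
    unitNormal g x ⬝ᵥ (g x *ᵥ unitNormal g x) = 1 := by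
  have hq := conormSq_pos hg hx
  rw [mulVec_unitNormal hg, unitNormal, smul_dotProduct, dotProduct_smul, dotProduct_comm,
    smul_eq_mul, smul_eq_mul, ← mul_assoc, ← mul_inv, Real.mul_self_sqrt hq.le]
  exact inv_mul_cancel₀ hq.ne'

/-- `ν_g` is `g`-orthogonal to the vectors tangent to the sphere. -/
theorem unitNormal_orthogonal {g : MatrixField} (hg : IsRiemannianMetric g) (x : E3)
    (v : Fin 3 → ℝ) (hv : v ⬝ᵥ x.ofLp = 0) : v ⬝ᵥ (g x *ᵥ unitNormal g x) = 0 := by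
  rw [mulVec_unitNormal hg, dotProduct_smul, hv, smul_zero]

/-- `ν_g` points outward. -/
theorem unitNormal_outward {g : MatrixField} (hg : IsRiemannianMetric g) {x : E3} (hx : x ≠ 0) :
    0 < x.ofLp ⬝ᵥ unitNormal g x := by
  have hq := conormSq_pos hg hx
  rw [unitNormal, dotProduct_smul]
  exact mul_pos (inv_pos.mpr (Real.sqrt_pos.mpr hq)) hq

/-- `areaDensity g x` is the `g`-area of the parallelogram spanned by a Euclidean orthonormal
basis `u, v` of the tangent plane at `x` of the sphere `{|y| = |x|}`. -/
theorem areaDensity_eq {g : MatrixField} (hg : IsRiemannianMetric g) {x : E3} (hx : x ≠ 0)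
    (u v : Fin 3 → ℝ) (huu : u ⬝ᵥ u = 1) (hvv : v ⬝ᵥ v = 1) (huv : u ⬝ᵥ v = 0)
    (hux : u ⬝ᵥ x.ofLp = 0) (hvx : v ⬝ᵥ x.ofLp = 0) :
    areaDensity g x = Real.sqrt
      ((u ⬝ᵥ (g x *ᵥ u)) * (v ⬝ᵥ (g x *ᵥ v)) - (u ⬝ᵥ (g x *ᵥ v)) ^ 2) := by
  have hn : 0 < ‖x‖ := norm_pos_iff.mpr hx
  have hadj : (g x).det * conormSq g x = x.ofLp ⬝ᵥ ((g x).adjugate *ᵥ x.ofLp) := by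
    rw [conormSq, Matrix.inv_def, Matrix.smul_mulVec, dotProduct_smul, smul_eq_mul,
      ← mul_assoc, Ring.inverse_eq_inv, mul_inv_cancel₀ (hg.posDef x).det_pos.ne', one_mul]
  have hnn : ‖x‖ ^ 2 = x 0 ^ 2 + x 1 ^ 2 + x 2 ^ 2 := by
    rw [EuclideanSpace.real_norm_sq_eq, Fin.sum_univ_three]
  have hsym : ∀ i j, g x i j = g x j i := fun i j => by
    simpa using (hg.posDef x).isHermitian.apply j i
  have hgram : ((u ⬝ᵥ (g x *ᵥ u)) * (v ⬝ᵥ (g x *ᵥ v)) - (u ⬝ᵥ (g x *ᵥ v)) ^ 2) =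
      (u ⨯₃ v) ⬝ᵥ ((g x).adjugate *ᵥ (u ⨯₃ v)) := by
    have h10 := hsym 1 0
    have h20 := hsym 2 0
    have h21 := hsym 2 1
    rw [Matrix.adjugate_fin_three]
    simp only [Matrix.mulVec, dotProduct, Fin.sum_univ_three, cross_apply, Matrix.cons_val,
      Matrix.of_apply, h10, h20, h21]
    ring
  have hpar : (‖x‖ ^ 2) • (u ⨯₃ v) = ((u ⨯₃ v) ⬝ᵥ x.ofLp) • x.ofLp := by
    have h := cross_cross_eq_smul_sub_smul u v x.ofLp
    rw [hux, hvx, zero_smul, zero_smul, sub_zero] at h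
    have h2 : x.ofLp ⨯₃ ((u ⨯₃ v) ⨯₃ x.ofLp) = 0 := by rw [h, map_zero]
    rw [cross_apply, cross_apply] at h2
    have e0 := congrFun h2 0
    have e1 := congrFun h2 1
    have e2 := congrFun h2 2
    simp only [Matrix.cons_val, Pi.zero_apply] at e0 e1 e2
    ext i
    rw [hnn]
    fin_cases i <;>
      simp only [Pi.smul_apply, smul_eq_mul, dotProduct, Fin.sum_univ_three, Fin.zero_eta,
        Fin.mk_one, Fin.reduceFinMk] <;> linarith
  have hone : (u ⨯₃ v) ⬝ᵥ (u ⨯₃ v) = 1 := by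
    rw [cross_dot_cross, huu, hvv, huv, dotProduct_comm v u, huv]; ring
  have hs : ((u ⨯₃ v) ⬝ᵥ x.ofLp) ^ 2 = ‖x‖ ^ 2 := by
    have h := congrArg (fun w => (u ⨯₃ v) ⬝ᵥ w) hpar
    simp only [dotProduct_smul, hone, smul_eq_mul, mul_one] at h
    rw [sq, h]
  have hsq : x.ofLp ⬝ᵥ ((g x).adjugate *ᵥ x.ofLp) =
      ‖x‖ ^ 2 * ((u ⨯₃ v) ⬝ᵥ ((g x).adjugate *ᵥ (u ⨯₃ v))) := by
    have h := congrArg (fun w => w ⬝ᵥ ((g x).adjugate *ᵥ w)) hpar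
    simp only [Matrix.mulVec_smul, dotProduct_smul, smul_dotProduct, smul_eq_mul] at h
    have h3 : ‖x‖ ^ 2 ≠ 0 := by positivity
    apply mul_left_cancel₀ h3
    rw [h, ← mul_assoc, ← sq, hs]
  rw [areaDensity, hadj, hsq, hgram, Real.sqrt_mul (by positivity), Real.sqrt_sq hn.le,
    mul_div_cancel_left₀ _ hn.ne']

end AsymSchwarzschild

/-!
Write `h = g - δ`. The linearization at `δ` of the scalar curvature is
`linearScalar g = g_{ij,ij} - g_{ii,jj}`, and the vector field
`X_j = x^α (g_{ij,i} - g_{ii,j}) - (h_{jα} - h_{ii} δ_{jα})` (`fluxField`) satisfies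
`div X = x^α linearScalar g` exactly (`sum_pderiv_fluxField`). The metric is smooth on all of
`ℝ³`, so the divergence theorem on `B(r)` (`integral_ball_div`) equates the linear part of the
curvature moment with the Euclidean flux of `X` through `{|x| = r}`, which is in turn the linear
part of `16 π m c_CS^α(r)`. What remains is to control the nonlinear remainder of each side.

A crude estimate of the remainders just fails: `x^α` times the quadratic terms of `R_g √(det g)` is
only `O(r⁻³)`, and the quadratic terms of the flux density are only `O(r⁻²)`. But integrals over
balls and spheres centred at the origin only see the even part of the integrand, and the
corresponding remainders of the Schwarzschild metric are odd functions of `x`, because that metric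
is even (`scalarRemainder_neg_of_even`, `fluxRemainder_neg_of_even`). So only the difference between
the remainders of `g` and of the Schwarzschild metric matters, and it decays one order faster. This
is the content of the relation `AgreesToNextOrder a u v`, which says that `u` and `v` are `O(r^a)`
and that `u - v` is `O(r^(a - 1))`: it is compatible with sums and products, so it passes from the
metrics to everything built from them (`MetricsAgree.scalarRemainder_agrees`,
`MetricsAgree.fluxRemainder_agrees`). Hence the remainder of the curvature moment converges
(`exists_tendsto_integral_scalarRemainder`), and that of the flux tends to zero
(`tendsto_sphereIntegral_fluxRemainder`).

The divergence theorem on balls is derived from integration by parts against compactly supported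
radial functions together with integration in polar coordinates.
-/

namespace AsymSchwarzschild

/-! ### Integration over coordinate spheres -/

theorem sphereIntegral_congr {f f' : E3 → ℝ} {r : ℝ} (hr : 0 < r)
    (h : ∀ x, ‖x‖ = r → f x = f' x) : sphereIntegral f r = sphereIntegral f' r := by
  unfold sphereIntegral
  congr 2
  funext z
  apply h
  rw [norm_smul, norm_eq_of_mem_sphere, mul_one, Real.norm_of_nonneg hr.le]

theorem continuous_comp_smul_sphere {f : E3 → ℝ} (hf : ContinuousOn f {0}ᶜ) {r : ℝ}
    (hr : 0 < r) : Continuous fun z : Metric.sphere (0 : E3) 1 => f (r • (z : E3)) := by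
  apply hf.comp_continuous (by fun_prop)
  intro z
  simpa using ⟨hr.ne', ne_zero_of_mem_unit_sphere z⟩

theorem integrable_comp_smul_sphere {f : E3 → ℝ} (hf : ContinuousOn f {0}ᶜ) {r : ℝ}
    (hr : 0 < r) : Integrable (fun z : Metric.sphere (0 : E3) 1 => f (r • (z : E3)))
      (volume : Measure E3).toSphere :=
  (continuous_comp_smul_sphere hf hr).integrable_of_hasCompactSupport
    (HasCompactSupport.of_compactSpace _)

theorem sphereIntegral_add {f f' : E3 → ℝ} (hf : ContinuousOn f {0}ᶜ)
    (hf' : ContinuousOn f' {0}ᶜ) {r : ℝ} (hr : 0 < r) :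
    sphereIntegral (fun x => f x + f' x) r = sphereIntegral f r + sphereIntegral f' r := by
  unfold sphereIntegral
  rw [integral_add (integrable_comp_smul_sphere hf hr) (integrable_comp_smul_sphere hf' hr),
    mul_add]

/-- The area measure of the unit sphere is invariant under the antipodal map. -/
theorem integral_toSphere_comp_neg (f : Metric.sphere (0 : E3) 1 → ℝ) :
    ∫ z, f (-z) ∂(volume : Measure E3).toSphere = ∫ z, f z ∂(volume : Measure E3).toSphere := by
  have hmp : MeasurePreserving (fun z : Metric.sphere (0 : E3) 1 => -z)
      (volume : Measure E3).toSphere (volume : Measure E3).toSphere := by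
    refine ⟨measurable_neg, ?_⟩
    ext s hs
    rw [Measure.map_apply measurable_neg hs, Measure.toSphere_apply' _ hs,
      Measure.toSphere_apply' _ (measurable_neg hs)]
    congr 1
    open scoped Pointwise in
    have : Set.Ioo (0 : ℝ) 1 • ((↑) '' ((fun z : Metric.sphere (0 : E3) 1 => -z) ⁻¹' s) : Set E3)
        = -(Set.Ioo (0 : ℝ) 1 • ((↑) '' s : Set E3)) := by
      ext x
      simp only [Set.mem_smul, Set.mem_neg, Set.mem_image, Set.mem_preimage]
      constructor
      · rintro ⟨t, ht, _, ⟨z, hz, rfl⟩, rfl⟩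
        exact ⟨t, ht, _, ⟨-z, hz, rfl⟩, by simp⟩
      · rintro ⟨t, ht, _, ⟨z, hz, rfl⟩, h⟩
        exact ⟨t, ht, _, ⟨-z, by simpa using hz, rfl⟩, by simp [h]⟩
    rw [this, Measure.measure_neg]
  exact hmp.integral_comp (Homeomorph.neg _).measurableEmbedding f

/-- The integral over a sphere only sees the even part of the integrand. -/
theorem sphereIntegral_eq_even_part {f : E3 → ℝ} (hf : ContinuousOn f {0}ᶜ) {r : ℝ}
    (hr : 0 < r) :
    sphereIntegral f r = sphereIntegral (fun x => (f x + f (-x)) / 2) r := by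
  unfold sphereIntegral
  have h1 := integral_toSphere_comp_neg fun z => f (r • (z : E3))
  have hi := integrable_comp_smul_sphere hf hr
  have hf' : ContinuousOn (fun x => f (-x)) {0}ᶜ :=
    hf.comp continuous_neg.continuousOn fun x hx => by simpa using hx
  have hi' := integrable_comp_smul_sphere hf' hr
  have h2 : ∫ z : Metric.sphere (0 : E3) 1, f (-(r • (z : E3))) ∂(volume : Measure E3).toSphere
      = ∫ z : Metric.sphere (0 : E3) 1, f (r • (z : E3)) ∂(volume : Measure E3).toSphere := by
    rw [← h1]
    congr 1
    funext z
    simp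
  rw [integral_div, integral_add hi hi', h2]
  ring

theorem abs_sphereIntegral_le {f : E3 → ℝ} {r C : ℝ} (hr : 0 < r)
    (h : ∀ x, ‖x‖ = r → |f x| ≤ C) :
    |sphereIntegral f r| ≤ r ^ 2 * (C * (volume : Measure E3).toSphere.real Set.univ) := by
  unfold sphereIntegral
  rw [abs_mul, abs_of_nonneg (sq_nonneg r)]
  gcongr
  rw [← Real.norm_eq_abs]
  refine norm_integral_le_of_norm_le_const (ae_of_all _ fun z => h _ ?_)
  rw [norm_smul, norm_eq_of_mem_sphere, mul_one, Real.norm_of_nonneg hr.le]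

theorem continuous_sphereIntegral {f : E3 → ℝ} (hf : Continuous f) :
    Continuous (sphereIntegral f) := by
  unfold sphereIntegral
  refine (continuous_pow 2).mul ?_
  have := continuous_parametric_integral_of_continuous
    (μ := (volume : Measure E3).toSphere) (s := Set.univ)
    (f := fun (r : ℝ) (z : Metric.sphere (0 : E3) 1) => f (r • (z : E3)))
    (by fun_prop) isCompact_univ
  simpa using this

/-- Integration in polar coordinates. -/
theorem integral_eq_integral_sphereIntegral {f : E3 → ℝ} (hf : Integrable f) :
    ∫ x, f x = ∫ s in Set.Ioi (0 : ℝ), sphereIntegral f s := by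
  have hmp := (volume : Measure E3).measurePreserving_homeomorphUnitSphereProd
  have hemb := (homeomorphUnitSphereProd E3).measurableEmbedding
  set F : Metric.sphere (0 : E3) 1 × Set.Ioi (0 : ℝ) → ℝ := fun p => f ((p.2 : ℝ) • (p.1 : E3))
    with hF
  have hcomp : F ∘ homeomorphUnitSphereProd E3 = fun x : ({0}ᶜ : Set E3) => f x := by
    funext x
    have hx : ‖(x : E3)‖ ≠ 0 := norm_ne_zero_iff.2 x.2
    simp [hF, homeomorphUnitSphereProd, smul_smul, hx]
  have hint : Integrable F ((volume : Measure E3).toSphere.prod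
      (Measure.volumeIoiPow (Module.finrank ℝ E3 - 1))) := by
    rw [← hmp.integrable_comp_emb hemb, hcomp]
    have := (integrableOn_iff_comap_subtypeVal (f := f) (μ := volume)
      (measurableSet_singleton (0 : E3)).compl).1 hf.integrableOn
    simpa [Function.comp_def] using this
  calc ∫ x, f x = ∫ x : ({0}ᶜ : Set E3), f x ∂((volume : Measure E3).comap (↑)) := by
        rw [integral_subtype_comap (measurableSet_singleton _).compl f, restrict_compl_singleton]
    _ = ∫ p, F p ∂(volume : Measure E3).toSphere.prod
          (Measure.volumeIoiPow (Module.finrank ℝ E3 - 1)) := by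
        rw [← hmp.integral_comp hemb F]
        exact congrArg
          (fun k => ∫ x : ({0}ᶜ : Set E3), k x ∂((volume : Measure E3).comap (↑))) hcomp.symm
    _ = ∫ s : Set.Ioi (0 : ℝ), (∫ z, F (z, s) ∂(volume : Measure E3).toSphere)
          ∂Measure.volumeIoiPow (Module.finrank ℝ E3 - 1) := integral_prod_symm F hint
    _ = _ := by
        simp only [Measure.volumeIoiPow, ENNReal.ofReal]
        rw [integral_withDensity_eq_integral_smul (by fun_prop),
          integral_subtype_comap measurableSet_Ioi fun a : ℝ =>
            Real.toNNReal (a ^ (Module.finrank ℝ E3 - 1)) •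
              ∫ z : Metric.sphere (0 : E3) 1, f (a • (z : E3)) ∂(volume : Measure E3).toSphere]
        refine setIntegral_congr_fun measurableSet_Ioi fun s hs => ?_
        have hs' : (0 : ℝ) ≤ s := le_of_lt hs
        simp only [NNReal.smul_def, sphereIntegral, finrank_euclideanSpace, Fintype.card_fin]
        rw [Real.coe_toNNReal _ (by positivity), smul_eq_mul]

theorem integral_ball_eq_integral_sphereIntegral {f : E3 → ℝ} (hf : Continuous f) {r : ℝ}
    (hr : 0 < r) :
    ∫ x in Metric.ball (0 : E3) r, f x = ∫ s in (0 : ℝ)..r, sphereIntegral f s := by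
  have hint : IntegrableOn f (Metric.ball (0 : E3) r) :=
    (hf.locallyIntegrable.integrableOn_isCompact (isCompact_closedBall 0 r)).mono_set
      Metric.ball_subset_closedBall
  rw [← integral_indicator measurableSet_ball, integral_eq_integral_sphereIntegral
    (hint.integrable_indicator measurableSet_ball), intervalIntegral.integral_of_le hr.le,
    integral_Ioc_eq_integral_Ioo, ← integral_indicator measurableSet_Ioi,
    ← integral_indicator measurableSet_Ioo]
  congr 1
  funext s
  by_cases hs : 0 < s
  · by_cases hsr : s < r
    · rw [Set.indicator_of_mem (Set.mem_Ioi.2 hs), Set.indicator_of_mem (Set.mem_Ioo.2 ⟨hs, hsr⟩)]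
      refine sphereIntegral_congr hs fun x hx => Set.indicator_of_mem ?_ _
      simpa [hx] using hsr
    · rw [Set.indicator_of_mem (Set.mem_Ioi.2 hs), Set.indicator_of_notMem (by simp [hsr])]
      rw [sphereIntegral_congr hs (f' := fun _ => 0)]
      · simp [sphereIntegral]
      · intro x hx
        exact Set.indicator_of_notMem (by simpa [hx] using hsr) _
  · rw [Set.indicator_of_notMem (by simpa using hs),
      Set.indicator_of_notMem (by simp [hs])]

/-! ### The divergence theorem on balls -/

theorem hasFDerivAt_norm_of_ne_zero {x : E3} (hx : x ≠ 0) :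
    HasFDerivAt (fun y : E3 => ‖y‖) (‖x‖⁻¹ • innerSL ℝ x) x := by
  have h2 := (hasStrictFDerivAt_norm_sq x).hasFDerivAt.sqrt (by simpa using hx)
  simp only [Real.sqrt_sq (norm_nonneg _)] at h2
  refine h2.congr_fderiv ?_
  have : ‖x‖ ≠ 0 := by simpa using hx
  rw [← Nat.cast_smul_eq_nsmul ℝ, smul_smul]
  congr 1
  push_cast
  field_simp

/-- A radial function `Φ(|x|)` with `Φ'(s) = s η(s)` has gradient `η(|x|) x`, also at the origin. -/
theorem hasFDerivAt_radial {Φ η : ℝ → ℝ} (hΦ : ∀ s, HasDerivAt Φ (s * η s) s) (x : E3) :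
    HasFDerivAt (fun y : E3 => Φ ‖y‖) (η ‖x‖ • innerSL ℝ x) x := by
  by_cases hx : x = 0
  · subst hx
    have h := (hΦ 0).isLittleO.comp_tendsto (k := fun y : E3 => ‖y‖) (l' := 𝓝 0)
      (by simpa using (continuous_norm (E := E3)).tendsto 0)
    rw [hasFDerivAt_iff_isLittleO]
    refine (h.congr_left fun y => ?_).trans_isBigO ?_
    · simp
    · exact Asymptotics.isBigO_of_le _ fun y => by simp
  · have h1 := hasFDerivAt_norm_of_ne_zero hx
    have h3 := (hΦ ‖x‖).comp_hasFDerivAt x h1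
    refine h3.congr_fderiv ?_
    have : ‖x‖ ≠ 0 := by simpa using hx
    rw [smul_smul]
    congr 1
    field_simp

theorem exists_primitive_eq_zero_of_le {η : ℝ → ℝ} (hη : Continuous η)
    (hc : HasCompactSupport η) :
    ∃ (Φ : ℝ → ℝ) (T : ℝ), 0 < T ∧ (∀ s, HasDerivAt Φ (s * η s) s) ∧ (∀ s, T ≤ s → Φ s = 0) ∧
      ∀ s, T ≤ s → η s = 0 := by
  obtain ⟨T, hT0, hT⟩ : ∃ T : ℝ, 0 < T ∧ ∀ s, T ≤ s → η s = 0 := by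
    obtain ⟨T, hT⟩ := hc.isCompact.isBounded.subset_ball_lt 0 0
    refine ⟨T, hT.1, fun s hs => ?_⟩
    by_contra hne
    have := hT.2 (subset_tsupport _ hne)
    simp only [Metric.mem_ball, dist_zero_right, Real.norm_eq_abs] at this
    linarith [le_abs_self s]
  have hcont : Continuous fun s => s * η s := by fun_prop
  refine ⟨fun s => ∫ t in T..s, t * η t, T, hT0, fun s => ?_, fun s hs => ?_, hT⟩
  · exact intervalIntegral.integral_hasDerivAt_right (hcont.intervalIntegrable _ _)
      (hcont.stronglyMeasurableAtFilter _ _) hcont.continuousAt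
  · simp only
    rw [intervalIntegral.integral_congr (g := fun _ => (0 : ℝ))]
    · simp
    · intro t ht
      rw [Set.uIcc_of_le hs] at ht
      simp [hT t ht.1]

/-- The divergence theorem tested against a radial cutoff: for `Φ' = s η`, the function
`x ↦ Φ(|x|)` has gradient `η(|x|) x`, so `∫ Φ(|x|) div X = - ∫ η(|x|) X · x`. -/
theorem integral_radial_mul_div {X : Fin 3 → E3 → ℝ} (hX : ∀ j, ContDiff ℝ 1 (X j))
    {Φ η : ℝ → ℝ} {T : ℝ} (hη : Continuous η) (hΦ : ∀ s, HasDerivAt Φ (s * η s) s)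
    (hΦT : ∀ s, T ≤ s → Φ s = 0) (hηT : ∀ s, T ≤ s → η s = 0) :
    ∫ x : E3, Φ ‖x‖ * ∑ j, pderiv j (X j) x = - ∫ x : E3, η ‖x‖ * ∑ j, X j x * x j := by
  have hcs : ∀ k : E3 → ℝ, (∀ x, T ≤ ‖x‖ → k x = 0) → HasCompactSupport k := fun k hk =>
    HasCompactSupport.intro (isCompact_closedBall (0 : E3) T) fun x hx => hk x (by
      simp at hx; exact hx.le)
  have hΦc : Continuous Φ := continuous_iff_continuousAt.2 fun s => (hΦ s).continuousAt
  have hpd : ∀ j, Continuous (pderiv j (X j)) := fun j =>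
    ((hX j).continuous_fderiv one_ne_zero).clm_apply continuous_const
  have hXc : ∀ j, Continuous (X j) := fun j => (hX j).continuous
  have hd : ∀ (j : Fin 3) (x : E3), fderiv ℝ (fun y : E3 => Φ ‖y‖) x (EuclideanSpace.single j 1)
      = η ‖x‖ * x j := fun j x => by
    rw [(hasFDerivAt_radial hΦ x).fderiv]
    simp [EuclideanSpace.inner_single_right]
  have hA : ∀ j, Integrable fun x : E3 => Φ ‖x‖ * pderiv j (X j) x := fun j => by
    have := hpd j
    refine Continuous.integrable_of_hasCompactSupport (by fun_prop)
      (hcs _ fun x hx => by simp [hΦT _ hx])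
  have hB : ∀ j, Integrable fun x : E3 => η ‖x‖ * x j * X j x := fun j => by
    have := hXc j
    refine Continuous.integrable_of_hasCompactSupport (by fun_prop)
      (hcs _ fun x hx => by simp [hηT _ hx])
  have hC : ∀ j, Integrable fun x : E3 => Φ ‖x‖ * X j x := fun j => by
    have := hXc j
    refine Continuous.integrable_of_hasCompactSupport (by fun_prop)
      (hcs _ fun x hx => by simp [hΦT _ hx])
  have key : ∀ j, ∫ x : E3, Φ ‖x‖ * pderiv j (X j) x = - ∫ x : E3, η ‖x‖ * x j * X j x :=
    fun j => by
    have := integral_mul_fderiv_eq_neg_fderiv_mul_of_integrable (μ := (volume : Measure E3))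
      (f := fun x : E3 => Φ ‖x‖) (g := X j) (v := EuclideanSpace.single j 1)
      (by simpa only [hd] using hB j) (hA j) (hC j)
      (fun x _ => (hasFDerivAt_radial hΦ x).differentiableAt)
      (fun x _ => (hX j).differentiable one_ne_zero x)
    simp only [hd] at this
    exact this
  simp only [Finset.mul_sum]
  simp only [mul_comm (X _ _), ← mul_assoc]
  rw [integral_finsetSum _ fun j _ => hA j, integral_finsetSum _ fun j _ => hB j,
    ← Finset.sum_neg_distrib]
  exact Finset.sum_congr rfl fun j _ => key j

/-- The divergence theorem on a Euclidean ball. Testing `div X` against radial cutoffs shows that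
the flux through the sphere of radius `s` and the integral of `div X` over the ball of radius `s`
agree for almost every `s`; both are continuous in `s`. -/
theorem integral_ball_div {X : Fin 3 → E3 → ℝ} (hX : ∀ j, ContDiff ℝ 1 (X j)) {r : ℝ}
    (hr : 0 < r) :
    ∫ x in Metric.ball (0 : E3) r, ∑ j, pderiv j (X j) x
      = sphereIntegral (fun x => ∑ j, X j x * (x j / ‖x‖)) r := by
  have hpd : ∀ j, Continuous (pderiv j (X j)) := fun j =>
    ((hX j).continuous_fderiv one_ne_zero).clm_apply continuous_const
  have hXc : ∀ j, Continuous (X j) := fun j => (hX j).continuous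
  have hdiv : Continuous fun x => ∑ j, pderiv j (X j) x := by fun_prop
  set G := sphereIntegral fun x => ∑ j, pderiv j (X j) x with hG
  have hGc : Continuous G := continuous_sphereIntegral hdiv
  -- `K s` is `s` times the flux; unlike the flux integrand, its integrand is continuous at `0`.
  set K := sphereIntegral fun x => ∑ j, X j x * x j with hK
  have hKc : Continuous K := continuous_sphereIntegral (by fun_prop)
  set H : ℝ → ℝ := fun s => ∫ t in (0 : ℝ)..s, G t with hH
  have hHd : ∀ s, HasDerivAt H (G s) s := fun s =>
    intervalIntegral.integral_hasDerivAt_right (hGc.intervalIntegrable _ _)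
      (hGc.stronglyMeasurableAtFilter _ _) hGc.continuousAt
  have hHc : Continuous H := continuous_iff_continuousAt.2 fun s => (hHd s).continuousAt
  have hae : ∀ᵐ s : ℝ, s ∈ Set.Ioi (0 : ℝ) → K s - s * H s = 0 := by
    apply isOpen_Ioi.ae_eq_zero_of_integral_contDiff_smul_eq_zero
    · exact (Continuous.locallyIntegrable (by fun_prop)).locallyIntegrableOn _
    intro η hη hηc hηs
    obtain ⟨Φ, T, hT, hΦ, hΦT, hηT⟩ := exists_primitive_eq_zero_of_le hη.continuous hηc
    have hηcont := hη.continuous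
    have hΦc : Continuous Φ := continuous_iff_continuousAt.2 fun s => (hΦ s).continuousAt
    have hcs : ∀ k : E3 → ℝ, (∀ x, T ≤ ‖x‖ → k x = 0) → HasCompactSupport k := fun k hk =>
      HasCompactSupport.intro (isCompact_closedBall (0 : E3) T) fun x hx => hk x (by
        simp at hx; exact hx.le)
    have hIoi : ∀ k : ℝ → ℝ, (∀ s, T ≤ s → k s = 0) →
        ∫ s in Set.Ioi (0 : ℝ), k s = ∫ s in (0 : ℝ)..T, k s := fun k hk => by
      rw [intervalIntegral.integral_of_le hT.le]
      refine (setIntegral_eq_of_subset_of_forall_sdiff_eq_zero measurableSet_Ioi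
        Set.Ioc_subset_Ioi_self fun s hs => hk s ?_)
      by_contra hlt
      exact hs.2 ⟨hs.1, (not_le.1 hlt).le⟩
    have h1 := integral_radial_mul_div hX hηcont hΦ hΦT hηT
    have hL : ∀ s ∈ Set.Ioi (0 : ℝ),
        sphereIntegral (fun x => Φ ‖x‖ * ∑ j, pderiv j (X j) x) s = Φ s * G s := fun s hs => by
      rw [sphereIntegral_congr hs (f' := fun x => Φ s * ∑ j, pderiv j (X j) x)
        (fun x hx => by rw [hx])]
      simp only [hG, sphereIntegral, integral_const_mul]
      ring
    have hR : ∀ s ∈ Set.Ioi (0 : ℝ),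
        sphereIntegral (fun x => η ‖x‖ * ∑ j, X j x * x j) s = η s * K s := fun s hs => by
      rw [sphereIntegral_congr hs (f' := fun x => η s * ∑ j, X j x * x j)
        (fun x hx => by rw [hx])]
      simp only [hK, sphereIntegral, integral_const_mul]
      ring
    rw [integral_eq_integral_sphereIntegral (Continuous.integrable_of_hasCompactSupport
        (by fun_prop) (hcs _ fun x hx => by simp [hΦT _ hx])),
      integral_eq_integral_sphereIntegral (Continuous.integrable_of_hasCompactSupport
        (by fun_prop) (hcs _ fun x hx => by simp [hηT _ hx])),
      setIntegral_congr_fun measurableSet_Ioi hL, setIntegral_congr_fun measurableSet_Ioi hR,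
      hIoi _ (fun s hs => by simp [hΦT s hs]), hIoi _ (fun s hs => by simp [hηT s hs])] at h1
    -- Since `H' = G` and `Φ' = s η`, integrating by parts in `s` turns `∫ Φ G = - ∫ η K` into
    -- `∫ η (K - s H) = 0`; the boundary terms vanish because `H 0 = 0` and `Φ T = 0`.
    have h2 := intervalIntegral.integral_mul_deriv_eq_deriv_mul (a := 0) (b := T)
      (u := Φ) (v := H) (u' := fun s => s * η s) (v' := G)
      (fun s _ => hΦ s) (fun s _ => hHd s)
      (Continuous.intervalIntegrable (by fun_prop) _ _) (hGc.intervalIntegrable _ _)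
    have hH0 : H 0 = 0 := by simp [hH]
    rw [hΦT T le_rfl, hH0, h1] at h2
    rw [← setIntegral_eq_integral_of_forall_compl_eq_zero (s := Set.Ioi (0 : ℝ)),
      hIoi _ (fun s hs => by simp [hηT s hs])]
    · have h3 : ∀ s, η s • (K s - s * H s) = η s * K s - s * η s * H s := fun s => by
        rw [smul_eq_mul]; ring
      simp only [h3]
      rw [intervalIntegral.integral_sub (Continuous.intervalIntegrable (by fun_prop) _ _)
        (Continuous.intervalIntegrable (by fun_prop) _ _)]
      linarith
    · intro s hs
      rw [image_eq_zero_of_notMem_tsupport fun h => hs (hηs h), zero_smul]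
  have heq : Set.EqOn (fun s => K s - s * H s) (fun _ => 0) (Set.Ioi (0 : ℝ)) := by
    refine Measure.eqOn_open_of_ae_eq (μ := (volume : Measure ℝ)) ?_ isOpen_Ioi
      (by fun_prop) (by fun_prop)
    exact (ae_restrict_iff' measurableSet_Ioi).2 hae
  have hKr : K r = r * H r := sub_eq_zero.1 (heq hr)
  rw [integral_ball_eq_integral_sphereIntegral hdiv hr,
    sphereIntegral_congr hr (f' := fun x => r⁻¹ * ∑ j, X j x * x j) (fun x hx => ?_)]
  · have : sphereIntegral (fun x => r⁻¹ * ∑ j, X j x * x j) r = r⁻¹ * K r := by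
      simp only [hK, sphereIntegral, integral_const_mul]
      ring
    rw [this, hKr]
    field_simp
    rfl
  · rw [hx, Finset.mul_sum]
    refine Finset.sum_congr rfl fun j _ => ?_
    field_simp

/-! ### Functions agreeing to next order at infinity -/

/-- `u` and `v` are both `O(r^a)` near infinity and agree there up to `O(r^(a - 1))`.
(The bound on `v` follows from the other two.) -/
def AgreesToNextOrder (a : ℤ) (u v : E3 → ℝ) : Prop :=
  u =O[Bornology.cobounded E3] (fun x => ‖x‖ ^ a) ∧
    (fun x => u x - v x) =O[Bornology.cobounded E3] fun x => ‖x‖ ^ (a - 1)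

/-- `u` and `v` both tend to the constant `c` at rate `O(r⁻¹)`, and agree up to `O(r⁻²)`. -/
def AgreesNearConst (c : ℝ) (u v : E3 → ℝ) : Prop :=
  AgreesToNextOrder (-1) (fun x => u x - c) (fun x => v x - c)

theorem eventually_one_le_norm : ∀ᶠ x : E3 in Bornology.cobounded E3, 1 ≤ ‖x‖ :=
  tendsto_norm_cobounded_atTop.eventually_ge_atTop 1

theorem isBigO_norm_zpow_of_le {a b : ℤ} (h : a ≤ b) :
    (fun x : E3 => ‖x‖ ^ a) =O[Bornology.cobounded E3] fun x => ‖x‖ ^ b := by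
  refine Asymptotics.IsBigO.of_bound 1 ?_
  filter_upwards [eventually_one_le_norm] with x hx
  rw [Real.norm_of_nonneg (by positivity), Real.norm_of_nonneg (by positivity), one_mul]
  exact zpow_le_zpow_right₀ hx h

theorem isBigO_mul_norm_zpow {u v : E3 → ℝ} {a b : ℤ}
    (hu : u =O[Bornology.cobounded E3] fun x => ‖x‖ ^ a)
    (hv : v =O[Bornology.cobounded E3] fun x => ‖x‖ ^ b) :
    (fun x => u x * v x) =O[Bornology.cobounded E3] fun x => ‖x‖ ^ (a + b) := by
  refine (hu.mul hv).congr' EventuallyEq.rfl ?_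
  filter_upwards [eventually_one_le_norm] with x hx
  rw [zpow_add₀ (by positivity)]

namespace AgreesToNextOrder

variable {a b : ℤ} {u v u' v' : E3 → ℝ}

theorem right (h : AgreesToNextOrder a u v) :
    v =O[Bornology.cobounded E3] fun x => ‖x‖ ^ a := by
  have := h.1.sub (h.2.trans (isBigO_norm_zpow_of_le (by omega)))
  simpa using this

theorem of_right (hv : v =O[Bornology.cobounded E3] fun x => ‖x‖ ^ a)
    (h : (fun x => u x - v x) =O[Bornology.cobounded E3] fun x => ‖x‖ ^ (a - 1)) :
    AgreesToNextOrder a u v := by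
  refine ⟨?_, h⟩
  have := hv.add (h.trans (isBigO_norm_zpow_of_le (by omega)))
  simpa using this

theorem refl (hu : u =O[Bornology.cobounded E3] fun x => ‖x‖ ^ a) :
    AgreesToNextOrder a u u :=
  of_right hu (by simpa using Asymptotics.isBigO_zero _ _)

theorem mono (h : AgreesToNextOrder a u v) (hab : a ≤ b) : AgreesToNextOrder b u v :=
  ⟨h.1.trans (isBigO_norm_zpow_of_le hab), h.2.trans (isBigO_norm_zpow_of_le (by omega))⟩

theorem congr (h : AgreesToNextOrder a u v) (hu : u' =ᶠ[Bornology.cobounded E3] u)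
    (hv : v' =ᶠ[Bornology.cobounded E3] v) : AgreesToNextOrder a u' v' :=
  ⟨h.1.congr' hu.symm EventuallyEq.rfl, h.2.congr' (hu.sub hv).symm EventuallyEq.rfl⟩

theorem add (h : AgreesToNextOrder a u v) (h' : AgreesToNextOrder a u' v') :
    AgreesToNextOrder a (fun x => u x + u' x) (fun x => v x + v' x) :=
  ⟨h.1.add h'.1, (h.2.add h'.2).congr_left fun x => by ring⟩

theorem neg (h : AgreesToNextOrder a u v) :
    AgreesToNextOrder a (fun x => -u x) (fun x => -v x) :=
  ⟨h.1.neg_left, h.2.neg_left.congr_left fun x => by ring⟩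

theorem sub (h : AgreesToNextOrder a u v) (h' : AgreesToNextOrder a u' v') :
    AgreesToNextOrder a (fun x => u x - u' x) (fun x => v x - v' x) := by
  simpa only [sub_eq_add_neg] using h.add h'.neg

theorem const_mul (c : ℝ) (h : AgreesToNextOrder a u v) :
    AgreesToNextOrder a (fun x => c * u x) (fun x => c * v x) :=
  ⟨h.1.const_mul_left c, (h.2.const_mul_left c).congr_left fun x => by ring⟩

theorem sum {ι : Type*} (s : Finset ι) {u v : ι → E3 → ℝ}
    (h : ∀ i ∈ s, AgreesToNextOrder a (u i) (v i)) :
    AgreesToNextOrder a (fun x => ∑ i ∈ s, u i x) (fun x => ∑ i ∈ s, v i x) := by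
  refine ⟨Asymptotics.IsBigO.fun_sum fun i hi => (h i hi).1, ?_⟩
  simp only [← Finset.sum_sub_distrib]
  exact Asymptotics.IsBigO.fun_sum fun i hi => (h i hi).2

/-- Orders add under multiplication, because `u u' - v v' = (u - v) u' + v (u' - v')`. -/
theorem mul (h : AgreesToNextOrder a u v) (h' : AgreesToNextOrder b u' v') :
    AgreesToNextOrder (a + b) (fun x => u x * u' x) (fun x => v x * v' x) := by
  refine ⟨isBigO_mul_norm_zpow h.1 h'.1, ?_⟩
  have h1 := isBigO_mul_norm_zpow h.2 h'.1
  have h2 := isBigO_mul_norm_zpow h.right h'.2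
  rw [show a - 1 + b = a + b - 1 by ring] at h1
  rw [show a + (b - 1) = a + b - 1 by ring] at h2
  exact (h1.add h2).congr_left fun x => by ring

end AgreesToNextOrder

namespace AgreesNearConst

variable {c d : ℝ} {u v u' v' : E3 → ℝ}

theorem const (c : ℝ) : AgreesNearConst c (fun _ => c) (fun _ => c) :=
  AgreesToNextOrder.refl (by simpa using Asymptotics.isBigO_zero _ _)

theorem agrees (h : AgreesNearConst c u v) : AgreesToNextOrder 0 u v := by
  have h1 := (AgreesToNextOrder.mono (b := 0) h (by norm_num)).add
    (AgreesToNextOrder.refl (u := fun _ => c)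
      (by simpa using Asymptotics.isBigO_const_const c (one_ne_zero (α := ℝ)) _))
  simpa using h1

theorem mul (h : AgreesNearConst c u v) (h' : AgreesNearConst d u' v') :
    AgreesNearConst (c * d) (fun x => u x * u' x) (fun x => v x * v' x) := by
  have h1 := (AgreesToNextOrder.mul h h'.agrees).add (AgreesToNextOrder.const_mul c h')
  refine h1.congr (.of_forall fun x => ?_) (.of_forall fun x => ?_) <;> ring

theorem sum {ι : Type*} (s : Finset ι) {c : ι → ℝ} {u v : ι → E3 → ℝ}
    (h : ∀ i ∈ s, AgreesNearConst (c i) (u i) (v i)) :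
    AgreesNearConst (∑ i ∈ s, c i) (fun x => ∑ i ∈ s, u i x) (fun x => ∑ i ∈ s, v i x) := by
  have h1 := AgreesToNextOrder.sum s h
  refine h1.congr (.of_forall fun x => ?_) (.of_forall fun x => ?_) <;>
    simp only [Finset.sum_sub_distrib]

theorem prod {ι : Type*} (s : Finset ι) {c : ι → ℝ} {u v : ι → E3 → ℝ}
    (h : ∀ i ∈ s, AgreesNearConst (c i) (u i) (v i)) :
    AgreesNearConst (∏ i ∈ s, c i) (fun x => ∏ i ∈ s, u i x) (fun x => ∏ i ∈ s, v i x) := by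
  classical
  induction s using Finset.induction_on with
  | empty => simpa using const 1
  | insert i s hi ih =>
    simp only [Finset.prod_insert hi]
    exact (h i (Finset.mem_insert_self i s)).mul
      (ih fun j hj => h j (Finset.mem_insert_of_mem hj))

theorem tendsto_of_isBigO {w : E3 → ℝ}
    (h : (fun x => w x - c) =O[Bornology.cobounded E3] fun x => ‖x‖ ^ (-1 : ℤ)) :
    Tendsto w (Bornology.cobounded E3) (𝓝 c) := by
  have h0 : Tendsto (fun x : E3 => ‖x‖ ^ (-1 : ℤ)) (Bornology.cobounded E3) (𝓝 0) := by
    simpa [Function.comp_def] using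
      tendsto_inv_atTop_zero.comp (tendsto_norm_cobounded_atTop (E := E3))
  exact tendsto_sub_nhds_zero_iff.1 (h.trans_tendsto h0)

theorem tendsto_left (h : AgreesNearConst c u v) :
    Tendsto u (Bornology.cobounded E3) (𝓝 c) :=
  tendsto_of_isBigO h.1

theorem tendsto_right (h : AgreesNearConst c u v) :
    Tendsto v (Bornology.cobounded E3) (𝓝 c) :=
  tendsto_of_isBigO (AgreesToNextOrder.right h)

/-- Composition with a function that is strictly differentiable, hence Lipschitz, near `c`. -/
theorem comp (h : AgreesNearConst c u v) {φ : ℝ → ℝ} {φ' : ℝ} (hφ : HasStrictDerivAt φ φ' c) :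
    AgreesNearConst (φ c) (fun x => φ (u x)) (fun x => φ (v x)) := by
  have hO : (fun p : ℝ × ℝ => φ p.1 - φ p.2) =O[𝓝 (c, c)] fun p => p.1 - p.2 :=
    hφ.hasStrictFDerivAt.isBigO_sub
  refine ⟨(hO.comp_tendsto (h.tendsto_left.prodMk_nhds tendsto_const_nhds)).trans h.1, ?_⟩
  have h1 := (hO.comp_tendsto (h.tendsto_left.prodMk_nhds h.tendsto_right)).trans
    (h.2.congr_left (f₂ := fun x => u x - v x) fun x => by ring)
  exact h1.congr_left fun x => by simp

end AgreesNearConst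

/-! ### Determinants and inverses of matrix fields near the identity -/

section Matrices

variable {n : Type*} [Fintype n] [DecidableEq n]

theorem AgreesNearConst.det {A B : E3 → Matrix n n ℝ} {C : Matrix n n ℝ}
    (h : ∀ i j, AgreesNearConst (C i j) (fun x => A x i j) (fun x => B x i j)) :
    AgreesNearConst C.det (fun x => (A x).det) (fun x => (B x).det) := by
  simp only [Matrix.det_apply']
  exact AgreesNearConst.sum _ fun σ _ => (AgreesNearConst.const _).mul
    (AgreesNearConst.prod _ fun i _ => h _ _)

theorem AgreesNearConst.adjugate {A B : E3 → Matrix n n ℝ} {C : Matrix n n ℝ}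
    (h : ∀ i j, AgreesNearConst (C i j) (fun x => A x i j) (fun x => B x i j)) (i j : n) :
    AgreesNearConst (C.adjugate i j) (fun x => (A x).adjugate i j)
      (fun x => (B x).adjugate i j) := by
  simp only [Matrix.adjugate_apply]
  refine AgreesNearConst.det fun k l => ?_
  by_cases hk : k = j
  · subst hk
    simpa only [Matrix.updateRow_self] using AgreesNearConst.const _
  · simpa only [Matrix.updateRow_ne hk] using h k l

theorem AgreesNearConst.inv {A B : E3 → Matrix n n ℝ}
    (h : ∀ i j, AgreesNearConst ((1 : Matrix n n ℝ) i j) (fun x => A x i j) (fun x => B x i j))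
    (i j : n) :
    AgreesNearConst ((1 : Matrix n n ℝ) i j) (fun x => (A x)⁻¹ i j) (fun x => (B x)⁻¹ i j) := by
  have hdet := AgreesNearConst.det h
  rw [Matrix.det_one] at hdet
  have h1 := (hdet.comp (hasStrictDerivAt_inv one_ne_zero)).mul (AgreesNearConst.adjugate h i j)
  simpa [Matrix.inv_def, Ring.inverse_eq_inv] using h1

theorem contDiffAt_det {A : E3 → Matrix n n ℝ} {x : E3} {k : WithTop ℕ∞}
    (h : ∀ i j, ContDiffAt ℝ k (fun y => A y i j) x) :
    ContDiffAt ℝ k (fun y => (A y).det) x := by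
  simp only [Matrix.det_apply']
  exact ContDiffAt.sum fun σ _ => contDiffAt_const.mul (contDiffAt_prod fun i _ => h _ _)

theorem contDiffAt_inv_entry {A : E3 → Matrix n n ℝ} {x : E3} {k : WithTop ℕ∞}
    (h : ∀ i j, ContDiffAt ℝ k (fun y => A y i j) x) (hdet : (A x).det ≠ 0) (i j : n) :
    ContDiffAt ℝ k (fun y => (A y)⁻¹ i j) x := by
  have hadj : ContDiffAt ℝ k (fun y => (A y).adjugate i j) x := by
    simp only [Matrix.adjugate_apply]
    refine contDiffAt_det fun p q => ?_
    by_cases hp : p = j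
    · subst hp
      simpa only [Matrix.updateRow_self] using contDiffAt_const
    · simpa only [Matrix.updateRow_ne hp] using h p q
  have h1 := ((contDiffAt_det h).inv hdet).mul hadj
  simpa [Matrix.inv_def, Ring.inverse_eq_inv] using h1

end Matrices

/-! ### Partial derivatives -/

section PartialDerivatives

variable {u v : E3 → ℝ} {x : E3} {i : Fin 3}

theorem pderiv_congr (h : u =ᶠ[𝓝 x] v) : pderiv i u x = pderiv i v x := by
  rw [pderiv, pderiv, h.fderiv_eq]

theorem pderiv_add (hu : DifferentiableAt ℝ u x) (hv : DifferentiableAt ℝ v x) :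
    pderiv i (fun y => u y + v y) x = pderiv i u x + pderiv i v x := by
  simp [pderiv, fderiv_fun_add hu hv]

theorem pderiv_sub (hu : DifferentiableAt ℝ u x) (hv : DifferentiableAt ℝ v x) :
    pderiv i (fun y => u y - v y) x = pderiv i u x - pderiv i v x := by
  simp [pderiv, fderiv_fun_sub hu hv]

theorem pderiv_mul (hu : DifferentiableAt ℝ u x) (hv : DifferentiableAt ℝ v x) :
    pderiv i (fun y => u y * v y) x = pderiv i u x * v x + u x * pderiv i v x := by
  simp [pderiv, fderiv_fun_mul hu hv]
  ring

theorem pderiv_const_mul (c : ℝ) (hu : DifferentiableAt ℝ u x) :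
    pderiv i (fun y => c * u y) x = c * pderiv i u x := by
  simp [pderiv, fderiv_const_mul hu]

theorem pderiv_sum {ι : Type*} {s : Finset ι} {u : ι → E3 → ℝ}
    (hu : ∀ k ∈ s, DifferentiableAt ℝ (u k) x) :
    pderiv i (fun y => ∑ k ∈ s, u k y) x = ∑ k ∈ s, pderiv i (u k) x := by
  simp [pderiv, fderiv_fun_sum hu]

theorem pderiv_const (c : ℝ) : pderiv i (fun _ => c) x = 0 := by
  simp [pderiv]

theorem contDiffAt_pderiv (hu : ContDiffAt ℝ ∞ u x) : ContDiffAt ℝ ∞ (pderiv i u) x :=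
  (hu.fderiv_right (m := ∞) (by simp)).clm_apply contDiffAt_const

theorem pderiv_neg_of_even (h : ∀ y, u (-y) = u y) : pderiv i u (-x) = -pderiv i u x := by
  have h1 := (ContinuousLinearEquiv.neg ℝ (M := E3)).comp_right_fderiv (f := u) (x := x)
  have h2 : u ∘ (ContinuousLinearEquiv.neg ℝ (M := E3)) = u := funext h
  rw [h2] at h1
  simp [pderiv, h1]

theorem pderiv_neg_of_odd (h : ∀ y, u (-y) = -u y) : pderiv i u (-x) = pderiv i u x := by
  have h1 := (ContinuousLinearEquiv.neg ℝ (M := E3)).comp_right_fderiv (f := u) (x := x)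
  have h2 : u ∘ (ContinuousLinearEquiv.neg ℝ (M := E3)) = -u := funext h
  rw [h2, fderiv_neg] at h1
  have h3 := congrArg (fun L : E3 →L[ℝ] ℝ => L (EuclideanSpace.single i 1)) h1
  simpa [pderiv] using h3.symm

end PartialDerivatives

/-! ### The Levi-Civita connection in coordinates -/

/-- `G` is smooth and nondegenerate at `x`. -/
def IsRegularAt (G : MatrixField) (x : E3) : Prop :=
  (∀ i j, ContDiffAt ℝ ∞ (fun y => G y i j) x) ∧ (G x).det ≠ 0

/-- The combination `∂_i G_{js} + ∂_j G_{is} - ∂_s G_{ij}`, twice the Christoffel symbol of the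
first kind. -/
noncomputable def christoffelLower (G : MatrixField) (i j s : Fin 3) (x : E3) : ℝ :=
  pderiv i (fun y => G y j s) x + pderiv j (fun y => G y i s) x - pderiv s (fun y => G y i j) x

/-- The linearization of the Ricci tensor at `δ`, applied to `G - δ`: the terms
`∂_k Γ^k_{ji} - ∂_j Γ^k_{ki}`, with `Γ^k_{ij}` replaced by half of `christoffelLower G i j k`. -/
noncomputable def linearRicci (G : MatrixField) (i j : Fin 3) (x : E3) : ℝ :=
  ∑ k, ((1 / 2) * pderiv k (christoffelLower G j i k) x
    - (1 / 2) * pderiv j (christoffelLower G k i k) x)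

/-- The linearization `∂_i ∂_j G_{ij} - ∂_j ∂_j G_{ii}` at `δ` of the scalar curvature, applied to
`G - δ`. -/
noncomputable def linearScalar (G : MatrixField) (x : E3) : ℝ :=
  ∑ j, ∑ i, (pderiv j (pderiv i fun y => G y i j) x - pderiv j (pderiv j fun y => G y i i) x)

/-- The density `R_G √(det G)` minus its linearization at `δ`. -/
noncomputable def scalarRemainder (G : MatrixField) (x : E3) : ℝ :=
  scalarCurvature G x * volumeDensity G x - linearScalar G x

section Regular

variable {G : MatrixField} {x : E3}

theorem IsRegularAt.eventually (h : IsRegularAt G x) : ∀ᶠ y in 𝓝 x, (G y).det ≠ 0 :=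
  (contDiffAt_det h.1).continuousAt.eventually_ne h.2

theorem IsRegularAt.contDiffAt_inv (h : IsRegularAt G x) (i j : Fin 3) :
    ContDiffAt ℝ ∞ (fun y => (G y)⁻¹ i j) x :=
  contDiffAt_inv_entry h.1 h.2 i j

theorem IsRegularAt.contDiffAt_christoffelLower (h : IsRegularAt G x) (i j s : Fin 3) :
    ContDiffAt ℝ ∞ (christoffelLower G i j s) x :=
  ((contDiffAt_pderiv (h.1 j s)).add (contDiffAt_pderiv (h.1 i s))).sub
    (contDiffAt_pderiv (h.1 i j))

theorem christoffel_eq (k i j : Fin 3) :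
    christoffel G k i j = fun x => (1 / 2) * ∑ s, (G x)⁻¹ k s * christoffelLower G i j s x :=
  rfl

theorem IsRegularAt.contDiffAt_christoffel (h : IsRegularAt G x) (k i j : Fin 3) :
    ContDiffAt ℝ ∞ (christoffel G k i j) x := by
  rw [christoffel_eq]
  exact contDiffAt_const.mul (ContDiffAt.sum fun s _ =>
    (h.contDiffAt_inv k s).mul (h.contDiffAt_christoffelLower i j s))

theorem IsRegularAt.contDiffAt_ricci (h : IsRegularAt G x) (i j : Fin 3) :
    ContDiffAt ℝ ∞ (ricci G i j) x := by
  have hc := h.contDiffAt_christoffel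
  exact (ContDiffAt.sum fun k _ => (contDiffAt_pderiv (hc _ _ _)).sub
    (contDiffAt_pderiv (hc _ _ _))).add (ContDiffAt.sum fun k _ => ContDiffAt.sum fun l _ =>
      ((hc _ _ _).mul (hc _ _ _)).sub ((hc _ _ _).mul (hc _ _ _)))

theorem IsRegularAt.contDiffAt_scalarCurvature (h : IsRegularAt G x) :
    ContDiffAt ℝ ∞ (scalarCurvature G) x :=
  ContDiffAt.sum fun i _ => ContDiffAt.sum fun j _ =>
    (h.contDiffAt_inv i j).mul (h.contDiffAt_ricci i j)

/-- `∂_k G⁻¹ = - G⁻¹ (∂_k G) G⁻¹`. -/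
theorem IsRegularAt.pderiv_inv (h : IsRegularAt G x) (k i j : Fin 3) :
    pderiv k (fun y => (G y)⁻¹ i j) x
      = -∑ a, ∑ b, (G x)⁻¹ i a * pderiv k (fun y => G y a b) x * (G x)⁻¹ b j := by
  have hG : ∀ a b, DifferentiableAt ℝ (fun y => G y a b) x := fun a b =>
    (h.1 a b).differentiableAt (by simp)
  have hI : ∀ a b, DifferentiableAt ℝ (fun y => (G y)⁻¹ a b) x := fun a b =>
    (h.contDiffAt_inv a b).differentiableAt (by simp)
  set D : Matrix (Fin 3) (Fin 3) ℝ := Matrix.of fun a b => pderiv k (fun y => (G y)⁻¹ a b) x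
    with hD
  set E : Matrix (Fin 3) (Fin 3) ℝ := Matrix.of fun a b => pderiv k (fun y => G y a b) x with hE
  have hsum : E * (G x)⁻¹ + G x * D = 0 := by
    ext a b
    have h1 : (fun y => ∑ s, G y a s * (G y)⁻¹ s b) =ᶠ[𝓝 x]
        fun _ => (1 : Matrix (Fin 3) (Fin 3) ℝ) a b := by
      filter_upwards [h.eventually] with y hy
      rw [← Matrix.mul_apply, Matrix.mul_nonsing_inv _ hy.isUnit]
    have h2 := pderiv_congr (i := k) h1
    rw [pderiv_const, pderiv_sum fun s _ => (hG a s).fun_mul (hI s b)] at h2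
    simp only [pderiv_mul (hG _ _) (hI _ _)] at h2
    simpa [Matrix.mul_apply, hD, hE, Finset.sum_add_distrib] using h2
  have hDeq : D = -((G x)⁻¹ * E * (G x)⁻¹) := by
    have h3 := congrArg (fun M => (G x)⁻¹ * M) hsum
    simp only [mul_add, mul_zero, ← mul_assoc, Matrix.nonsing_inv_mul _ h.2.isUnit, one_mul] at h3
    exact eq_neg_of_add_eq_zero_right h3
  have h4 := congrFun (congrFun hDeq i) j
  simp only [hD, hE, Matrix.of_apply, Matrix.neg_apply, Matrix.mul_apply, Finset.sum_mul] at h4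
  rw [h4, Finset.sum_comm]

theorem IsRegularAt.pderiv_christoffelLower (h : IsRegularAt G x) (l i j s : Fin 3) :
    pderiv l (christoffelLower G i j s) x
      = pderiv l (pderiv i fun y => G y j s) x + pderiv l (pderiv j fun y => G y i s) x
        - pderiv l (pderiv s fun y => G y i j) x := by
  have hd : ∀ k a b, DifferentiableAt ℝ (pderiv k fun y => G y a b) x := fun k a b =>
    (contDiffAt_pderiv (h.1 a b)).differentiableAt (by simp)
  rw [← pderiv_add (hd i j s) (hd j i s), ← pderiv_sub ((hd i j s).fun_add (hd j i s)) (hd s i j)]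
  rfl

theorem IsRegularAt.pderiv_christoffel (h : IsRegularAt G x) (l k i j : Fin 3) :
    pderiv l (christoffel G k i j) x
      = (1 / 2) * ∑ s, (pderiv l (fun y => (G y)⁻¹ k s) x * christoffelLower G i j s x
          + (G x)⁻¹ k s * pderiv l (christoffelLower G i j s) x) := by
  have hI : ∀ a b, DifferentiableAt ℝ (fun y => (G y)⁻¹ a b) x := fun a b =>
    (h.contDiffAt_inv a b).differentiableAt (by simp)
  have hL : ∀ s, DifferentiableAt ℝ (christoffelLower G i j s) x := fun s =>
    (h.contDiffAt_christoffelLower i j s).differentiableAt (by simp)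
  rw [christoffel_eq, pderiv_const_mul _
    (DifferentiableAt.fun_sum fun s _ => (hI k s).fun_mul (hL s)),
    pderiv_sum fun s _ => (hI k s).fun_mul (hL s)]
  simp only [pderiv_mul (hI _ _) (hL _)]

/-- The trace of the linearized Ricci tensor is the linearized scalar curvature. -/
theorem IsRegularAt.sum_linearRicci (h : IsRegularAt G x) (hsymm : ∀ y i j, G y i j = G y j i) :
    ∑ i, linearRicci G i i x = linearScalar G x := by
  have hs : ∀ i j, (fun y => G y i j) = fun y => G y j i := fun i j => funext fun y => hsymm y i j
  have h10 := hs 1 0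
  have h20 := hs 2 0
  have h21 := hs 2 1
  simp only [linearRicci, linearScalar, h.pderiv_christoffelLower, Fin.sum_univ_three, h10, h20,
    h21]
  ring

end Regular

/-! ### Two metrics agreeing to next order -/

/-- Near infinity, `G` and `S` are smooth metrics which are close to `δ` and to each other, in the
way an asymptotically Schwarzschild metric and the Schwarzschild metric are: `G - δ` and `S - δ`
are `O(r⁻¹)`, their difference is `O(r⁻²)`, and each of two derivatives gains one order. -/
structure MetricsAgree (G S : MatrixField) : Prop where
  smooth_left : ∀ᶠ x in Bornology.cobounded E3, ∀ i j, ContDiffAt ℝ ∞ (fun y => G y i j) x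
  smooth_right : ∀ᶠ x in Bornology.cobounded E3, ∀ i j, ContDiffAt ℝ ∞ (fun y => S y i j) x
  symm_left : ∀ x i j, G x i j = G x j i
  symm_right : ∀ x i j, S x i j = S x j i
  metric : ∀ i j, AgreesNearConst ((1 : Matrix (Fin 3) (Fin 3) ℝ) i j)
    (fun x => G x i j) (fun x => S x i j)
  pderiv_agrees : ∀ k i j, AgreesToNextOrder (-2)
    (pderiv k fun x => G x i j) (pderiv k fun x => S x i j)
  pderiv_pderiv_agrees : ∀ l k i j, AgreesToNextOrder (-3)
    (pderiv l (pderiv k fun x => G x i j))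
    (pderiv l (pderiv k fun x => S x i j))

namespace MetricsAgree

variable {G S : MatrixField}

theorem det (h : MetricsAgree G S) :
    AgreesNearConst 1 (fun x => (G x).det) (fun x => (S x).det) := by
  simpa only [Matrix.det_one] using AgreesNearConst.det h.metric

theorem inv (h : MetricsAgree G S) (i j : Fin 3) :
    AgreesNearConst ((1 : Matrix (Fin 3) (Fin 3) ℝ) i j) (fun x => (G x)⁻¹ i j)
      (fun x => (S x)⁻¹ i j) :=
  AgreesNearConst.inv h.metric i j

theorem volumeDensity_agrees (h : MetricsAgree G S) :
    AgreesNearConst 1 (volumeDensity G) (volumeDensity S) := by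
  simpa using! h.det.comp (Real.hasStrictDerivAt_sqrt one_ne_zero)

theorem regular_left (h : MetricsAgree G S) :
    ∀ᶠ x in Bornology.cobounded E3, IsRegularAt G x :=
  h.smooth_left.and (h.det.tendsto_left.eventually_ne one_ne_zero)

theorem regular_right (h : MetricsAgree G S) :
    ∀ᶠ x in Bornology.cobounded E3, IsRegularAt S x :=
  h.smooth_right.and (h.det.tendsto_right.eventually_ne one_ne_zero)

theorem pderiv_inv (h : MetricsAgree G S) (k i j : Fin 3) :
    AgreesToNextOrder (-2) (pderiv k fun x => (G x)⁻¹ i j)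
      (pderiv k fun x => (S x)⁻¹ i j) := by
  have h1 := (AgreesToNextOrder.sum Finset.univ fun a _ => AgreesToNextOrder.sum Finset.univ
    fun b _ => ((h.inv i a).agrees.mul (h.pderiv_agrees k a b)).mul (h.inv b j).agrees).neg
  exact (h1.congr (h.regular_left.mono fun _ hx => hx.pderiv_inv k i j)
    (h.regular_right.mono fun _ hx => hx.pderiv_inv k i j)).mono (by norm_num)

theorem christoffelLower_agrees (h : MetricsAgree G S) (i j s : Fin 3) :
    AgreesToNextOrder (-2) (christoffelLower G i j s) (christoffelLower S i j s) :=
  ((h.pderiv_agrees i j s).add (h.pderiv_agrees j i s)).sub (h.pderiv_agrees s i j)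

theorem pderiv_christoffelLower_agrees (h : MetricsAgree G S) (l i j s : Fin 3) :
    AgreesToNextOrder (-3) (pderiv l (christoffelLower G i j s))
      (pderiv l (christoffelLower S i j s)) :=
  (((h.pderiv_pderiv_agrees l i j s).add (h.pderiv_pderiv_agrees l j i s)).sub
    (h.pderiv_pderiv_agrees l s i j)).congr
    (h.regular_left.mono fun _ hx => hx.pderiv_christoffelLower l i j s)
    (h.regular_right.mono fun _ hx => hx.pderiv_christoffelLower l i j s)

theorem christoffel_agrees (h : MetricsAgree G S) (k i j : Fin 3) :
    AgreesToNextOrder (-2) (christoffel G k i j) (christoffel S k i j) :=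
  (AgreesToNextOrder.const_mul (1 / 2) (AgreesToNextOrder.sum Finset.univ fun s _ =>
    (h.inv k s).agrees.mul (h.christoffelLower_agrees i j s))).mono (by norm_num)

/-- The derivative of a Christoffel symbol minus its linearization is quadratic in `G - δ`: each of
its terms is a product of an `O(r⁻²)` with an `O(r⁻²)`, or of an `O(r⁻¹)` with an `O(r⁻³)`. -/
theorem pderiv_christoffel_sub (h : MetricsAgree G S) (l k i j : Fin 3) :
    AgreesToNextOrder (-4)
      (fun x => pderiv l (christoffel G k i j) x
        - (1 / 2) * pderiv l (christoffelLower G i j k) x)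
      (fun x => pderiv l (christoffel S k i j) x
        - (1 / 2) * pderiv l (christoffelLower S i j k) x) := by
  have h1 := AgreesToNextOrder.const_mul (1 / 2) (AgreesToNextOrder.sum Finset.univ fun s _ =>
    ((h.pderiv_inv l k s).mul (h.christoffelLower_agrees i j s)).add
      ((AgreesToNextOrder.mul (h.inv k s) (h.pderiv_christoffelLower_agrees l i j s)).mono
        (b := -2 + -2) (by norm_num)))
  have key : ∀ (A : MatrixField) (x : E3), IsRegularAt A x →
      pderiv l (christoffel A k i j) x
        - (1 / 2) * pderiv l (christoffelLower A i j k) x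
      = (1 / 2) * ∑ s, (pderiv l (fun y => (A y)⁻¹ k s) x
            * christoffelLower A i j s x
          + ((A x)⁻¹ k s - (1 : Matrix (Fin 3) (Fin 3) ℝ) k s)
            * pderiv l (christoffelLower A i j s) x) := by
    intro A x hx
    rw [hx.pderiv_christoffel, ← mul_sub]
    congr 1
    simp only [sub_mul, Finset.sum_add_distrib, Finset.sum_sub_distrib, Matrix.one_apply, ite_mul,
      one_mul, zero_mul, Finset.sum_ite_eq, Finset.mem_univ, if_true]
    ring
  exact h1.congr (h.regular_left.mono (key G)) (h.regular_right.mono (key S))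

theorem ricci_sub (h : MetricsAgree G S) (i j : Fin 3) :
    AgreesToNextOrder (-4) (fun x => ricci G i j x - linearRicci G i j x)
      (fun x => ricci S i j x - linearRicci S i j x) := by
  have h1 := (AgreesToNextOrder.sum Finset.univ fun k _ =>
    (h.pderiv_christoffel_sub k k j i).sub (h.pderiv_christoffel_sub j k k i)).add
    (AgreesToNextOrder.sum Finset.univ fun k _ => AgreesToNextOrder.sum Finset.univ fun l _ =>
      ((h.christoffel_agrees k k l).mul (h.christoffel_agrees l j i)).sub
        ((h.christoffel_agrees k j l).mul (h.christoffel_agrees l k i)))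
  refine h1.congr (.of_forall fun x => ?_) (.of_forall fun x => ?_) <;>
  · simp only [ricci, linearRicci, Finset.sum_sub_distrib]
    ring

theorem linearRicci_agrees (h : MetricsAgree G S) (i j : Fin 3) :
    AgreesToNextOrder (-3) (linearRicci G i j) (linearRicci S i j) :=
  AgreesToNextOrder.sum Finset.univ fun k _ =>
    ((h.pderiv_christoffelLower_agrees k j i k).const_mul (1 / 2)).sub
      ((h.pderiv_christoffelLower_agrees j k i k).const_mul (1 / 2))

theorem ricci_agrees (h : MetricsAgree G S) (i j : Fin 3) :
    AgreesToNextOrder (-3) (ricci G i j) (ricci S i j) := by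
  have h1 := ((h.ricci_sub i j).mono (b := -3) (by norm_num)).add (h.linearRicci_agrees i j)
  refine h1.congr (.of_forall fun x => ?_) (.of_forall fun x => ?_) <;> ring

/-- The entries of `√(det G) G⁻¹ - 1`, of which the densitized scalar curvature and normal are
built. -/
theorem densitized_inv (h : MetricsAgree G S) (i j : Fin 3) :
    AgreesNearConst ((1 : Matrix (Fin 3) (Fin 3) ℝ) i j)
      (fun x => volumeDensity G x * (G x)⁻¹ i j)
      (fun x => volumeDensity S x * (S x)⁻¹ i j) := by
  simpa only [one_mul] using h.volumeDensity_agrees.mul (h.inv i j)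

/-- The nonlinear part of the curvature density agrees to next order with that of the model. -/
theorem scalarRemainder_agrees (h : MetricsAgree G S) :
    AgreesToNextOrder (-4) (scalarRemainder G) (scalarRemainder S) := by
  have h1 := AgreesToNextOrder.sum Finset.univ fun i _ => AgreesToNextOrder.sum Finset.univ
    fun j _ => (AgreesToNextOrder.mul (h.densitized_inv i j) (h.ricci_agrees i j)).add
      (AgreesToNextOrder.const_mul ((1 : Matrix (Fin 3) (Fin 3) ℝ) i j) (h.ricci_sub i j))
  have key : ∀ (A : MatrixField) (x : E3), (∀ y i j, A y i j = A y j i) → IsRegularAt A x →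
      scalarRemainder A x
      = ∑ i, ∑ j, ((volumeDensity A x * (A x)⁻¹ i j
            - (1 : Matrix (Fin 3) (Fin 3) ℝ) i j) * ricci A i j x
          + (1 : Matrix (Fin 3) (Fin 3) ℝ) i j
            * (ricci A i j x - linearRicci A i j x)) := by
    intro A x hs hx
    have h2 : linearScalar A x = ∑ i, ∑ j, (1 : Matrix (Fin 3) (Fin 3) ℝ) i j
        * linearRicci A i j x := by
      simp [← hx.sum_linearRicci hs, Matrix.one_apply]
    rw [scalarRemainder, scalarCurvature, h2]
    simp only [Finset.sum_mul, ← Finset.sum_sub_distrib]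
    refine Finset.sum_congr rfl fun i _ => Finset.sum_congr rfl fun j _ => ?_
    ring
  exact h1.congr (h.regular_left.mono fun x => key G x h.symm_left)
    (h.regular_right.mono fun x => key S x h.symm_right)

end MetricsAgree

/-! ### The flux through coordinate spheres -/

/-- The vector field `x^α (G_{ij,i} - G_{ii,j}) - (h_{jα} - h_{ii} δ_{jα})`, with `h = G - δ`, whose
flux through coordinate spheres is the leading part of the Corvino–Schoen center. -/
noncomputable def fluxField (G : MatrixField) (α j : Fin 3) (x : E3) : ℝ :=
  x α * ∑ i, (pderiv i (fun y => G y i j) x - pderiv j (fun y => G y i i) x)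
    - ((G x - 1) j α - (∑ i, (G x - 1) i i) * (1 : Matrix (Fin 3) (Fin 3) ℝ) j α)

/-- The difference between the density `⟨X, ν_G⟩ dσ_G / dσ_0` and its Euclidean counterpart
`⟨X, x / |x|⟩`, where `X = fluxField G α` and `ν_G dσ_G = √(det G) G⁻¹ (x / |x|) dσ_0`. -/
noncomputable def fluxRemainder (G : MatrixField) (α : Fin 3) (x : E3) : ℝ :=
  ∑ j, fluxField G α j x * ∑ k, (volumeDensity G x * (G x)⁻¹ j k
    - (1 : Matrix (Fin 3) (Fin 3) ℝ) j k) * (x k / ‖x‖)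

theorem csIntegrand_eq_sum_fluxField {G : MatrixField} (hsymm : ∀ x i j, G x i j = G x j i)
    (α : Fin 3) (x : E3) : csIntegrand G α x = ∑ j, fluxField G α j x * unitNormal G x j := by
  have h10 := hsymm x 1 0
  have h20 := hsymm x 2 0
  have h21 := hsymm x 2 1
  simp only [csIntegrand, fluxField, Fin.sum_univ_three, Matrix.sub_apply]
  obtain rfl | rfl | rfl : α = 0 ∨ α = 1 ∨ α = 2 := by omega
  all_goals
    simp [h10, h20, h21]
    ring

/-- `ν_g dσ_g = √(det g) g⁻¹ (x / |x|) dσ_0`. -/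
theorem unitNormal_mul_areaDensity {g : MatrixField} (hg : IsRiemannianMetric g) {x : E3}
    (hx : x ≠ 0) (j : Fin 3) :
    unitNormal g x j * areaDensity g x
      = volumeDensity g x * ∑ k, (g x)⁻¹ j k * (x k / ‖x‖) := by
  have hq := Real.sqrt_pos.2 (conormSq_pos hg hx)
  have hn : ‖x‖ ≠ 0 := norm_ne_zero_iff.2 hx
  rw [areaDensity, Real.sqrt_mul (hg.posDef x).det_pos.le, unitNormal, volumeDensity]
  simp only [Pi.smul_apply, smul_eq_mul, Matrix.mulVec, dotProduct, ← mul_div_assoc,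
    ← Finset.sum_div]
  field_simp

theorem csIntegrand_mul_areaDensity {g : MatrixField} (hg : IsRiemannianMetric g)
    (hsymm : ∀ x i j, g x i j = g x j i) (α : Fin 3) {x : E3} (hx : x ≠ 0) :
    csIntegrand g α x * areaDensity g x
      = ∑ j, fluxField g α j x * (x j / ‖x‖) + fluxRemainder g α x := by
  rw [csIntegrand_eq_sum_fluxField hsymm, Finset.sum_mul, fluxRemainder, ← Finset.sum_add_distrib]
  refine Finset.sum_congr rfl fun j _ => ?_
  rw [mul_assoc, unitNormal_mul_areaDensity hg hx, ← mul_add]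
  congr 1
  simp only [sub_mul, Finset.sum_sub_distrib, Matrix.one_apply, ite_mul, one_mul, zero_mul,
    Finset.sum_ite_eq, Finset.mem_univ, if_true, Finset.mul_sum, mul_assoc]
  ring

theorem contDiff_pderiv {u : E3 → ℝ} (hu : ContDiff ℝ ∞ u) (i : Fin 3) :
    ContDiff ℝ ∞ (pderiv i u) :=
  contDiff_iff_contDiffAt.2 fun _ => contDiffAt_pderiv hu.contDiffAt

theorem contDiff_coord (α : Fin 3) : ContDiff ℝ ∞ fun x : E3 => x α :=
  (EuclideanSpace.proj (𝕜 := ℝ) α).contDiff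

theorem pderiv_coord (j α : Fin 3) (x : E3) :
    pderiv j (fun y : E3 => y α) x = (1 : Matrix (Fin 3) (Fin 3) ℝ) j α := by
  have : fderiv ℝ (fun y : E3 => y α) x = EuclideanSpace.proj (𝕜 := ℝ) α :=
    (EuclideanSpace.proj (𝕜 := ℝ) α).fderiv
  simp [pderiv, this, Matrix.one_apply, eq_comm]

theorem contDiff_fluxField {g : MatrixField} (hg : ∀ i j, ContDiff ℝ ∞ fun x => g x i j)
    (α j : Fin 3) : ContDiff ℝ ∞ (fluxField g α j) := by
  have h1 : ∀ i j k, ContDiff ℝ ∞ (pderiv k fun y => g y i j) := fun i j k =>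
    contDiff_pderiv (hg i j) k
  have h2 := contDiff_coord α
  unfold fluxField
  simp only [Matrix.sub_apply]
  fun_prop

/-- The flux field was chosen so that its divergence is `x^α` times the linearized scalar
curvature: the lower order terms cancel. -/
theorem sum_pderiv_fluxField {g : MatrixField} (hg : ∀ i j, ContDiff ℝ ∞ fun x => g x i j)
    (hsymm : ∀ x i j, g x i j = g x j i) (α : Fin 3) (x : E3) :
    ∑ j, pderiv j (fluxField g α j) x = x α * linearScalar g x := by
  have hd : ∀ i j, DifferentiableAt ℝ (fun y => g y i j) x := fun i j =>
    (hg i j).differentiable (by simp) x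
  have hdd : ∀ k i j, DifferentiableAt ℝ (pderiv k fun y => g y i j) x := fun k i j =>
    (contDiff_pderiv (hg i j) k).differentiable (by simp) x
  have hc : DifferentiableAt ℝ (fun y : E3 => y α) x :=
    (contDiff_coord α).differentiable (by simp) x
  have key : ∀ j, pderiv j (fluxField g α j) x
      = (1 : Matrix (Fin 3) (Fin 3) ℝ) j α
          * ∑ i, (pderiv i (fun y => g y i j) x - pderiv j (fun y => g y i i) x)
        + x α * ∑ i, (pderiv j (pderiv i fun y => g y i j) x
            - pderiv j (pderiv j fun y => g y i i) x)
        - (pderiv j (fun y => g y j α) x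
            - (1 : Matrix (Fin 3) (Fin 3) ℝ) j α * ∑ i, pderiv j (fun y => g y i i) x) := by
    intro j
    have hS : ∀ i, DifferentiableAt ℝ
        (fun y => pderiv i (fun y => g y i j) y - pderiv j (fun y => g y i i) y) x := fun i =>
      (hdd i i j).fun_sub (hdd j i i)
    have hSum : DifferentiableAt ℝ
        (fun y => ∑ i, (pderiv i (fun y => g y i j) y - pderiv j (fun y => g y i i) y)) x :=
      DifferentiableAt.fun_sum fun i _ => hS i
    have hT : ∀ i k, DifferentiableAt ℝ
        (fun y => g y i k - (1 : Matrix (Fin 3) (Fin 3) ℝ) i k) x := fun i k =>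
      (hd i k).fun_sub (differentiableAt_const _)
    have hTr : DifferentiableAt ℝ
        (fun y => ∑ i, (g y i i - (1 : Matrix (Fin 3) (Fin 3) ℝ) i i)) x :=
      DifferentiableAt.fun_sum fun i _ => hT i i
    have hp : ∀ i k, pderiv j (fun y => g y i k - (1 : Matrix (Fin 3) (Fin 3) ℝ) i k) x
        = pderiv j (fun y => g y i k) x := fun i k => by
      rw [pderiv_sub (hd i k) (differentiableAt_const _), pderiv_const, sub_zero]
    have hflux : fluxField g α j = fun x =>
        x α * ∑ i, (pderiv i (fun y => g y i j) x - pderiv j (fun y => g y i i) x)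
          - ((g x j α - (1 : Matrix (Fin 3) (Fin 3) ℝ) j α)
            - (1 : Matrix (Fin 3) (Fin 3) ℝ) j α
              * ∑ i, (g x i i - (1 : Matrix (Fin 3) (Fin 3) ℝ) i i)) := by
      funext y
      simp only [fluxField, Matrix.sub_apply]
      ring
    rw [hflux, pderiv_sub (hc.fun_mul hSum) ((hT j α).fun_sub (hTr.const_mul _)),
      pderiv_mul hc hSum, pderiv_coord, pderiv_sum fun i _ => hS i,
      pderiv_sub (hT j α) (hTr.const_mul _), pderiv_const_mul _ hTr,
      pderiv_sum fun i _ => hT i i, hp]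
    simp only [hp, pderiv_sub (hdd _ _ _) (hdd _ _ _)]
  have hs : ∀ i j, (fun y => g y i j) = fun y => g y j i := fun i j => funext fun y => hsymm y i j
  have h10 := hs 1 0
  have h20 := hs 2 0
  have h21 := hs 2 1
  simp only [key, linearScalar, Fin.sum_univ_three, h10, h20, h21]
  obtain rfl | rfl | rfl : α = 0 ∨ α = 1 ∨ α = 2 := by omega
  all_goals
    simp [h10, h20, h21]
    ring

theorem MetricsAgree.fluxField_agrees {G S : MatrixField} (h : MetricsAgree G S) (α j : Fin 3) :
    AgreesToNextOrder (-1) (fluxField G α j) (fluxField S α j) := by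
  have hx : AgreesToNextOrder 1 (fun x : E3 => x α) (fun x : E3 => x α) :=
    AgreesToNextOrder.refl (Asymptotics.isBigO_of_le _ fun x => by
      simpa using PiLp.norm_apply_le x α)
  have h1 := (hx.mul (AgreesToNextOrder.sum Finset.univ fun i _ =>
    (h.pderiv_agrees i i j).sub (h.pderiv_agrees j i i))).sub
    (AgreesToNextOrder.sub (h.metric j α) (AgreesToNextOrder.const_mul
      ((1 : Matrix (Fin 3) (Fin 3) ℝ) j α) (AgreesToNextOrder.sum Finset.univ fun i _ =>
        h.metric i i)))
  refine h1.congr (.of_forall fun x => ?_) (.of_forall fun x => ?_) <;>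
  · simp only [fluxField, Matrix.sub_apply]
    ring

theorem MetricsAgree.fluxRemainder_agrees {G S : MatrixField} (h : MetricsAgree G S)
    (α : Fin 3) : AgreesToNextOrder (-2) (fluxRemainder G α) (fluxRemainder S α) := by
  have hx : ∀ k, AgreesToNextOrder 0 (fun x : E3 => x k / ‖x‖) (fun x : E3 => x k / ‖x‖) :=
    fun k => AgreesToNextOrder.refl (Asymptotics.IsBigO.of_bound 1 (.of_forall fun x => by
      rw [norm_div, norm_norm]
      simpa using div_le_one_of_le₀ (PiLp.norm_apply_le x k) (norm_nonneg x)))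
  exact (AgreesToNextOrder.sum Finset.univ fun j _ => (h.fluxField_agrees α j).mul
    (AgreesToNextOrder.sum Finset.univ fun k _ =>
      AgreesToNextOrder.mul (h.densitized_inv j k) (hx k))).mono (by norm_num)

/-! ### Parity -/

section Parity

variable {S : MatrixField}

theorem christoffel_neg_of_even (hS : ∀ x, S (-x) = S x) (k i j : Fin 3) (x : E3) :
    christoffel S k i j (-x) = -christoffel S k i j x := by
  have h1 : ∀ i j k, pderiv k (fun y => S y i j) (-x) = -pderiv k (fun y => S y i j) x :=
    fun i j k => pderiv_neg_of_even fun z => by rw [hS]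
  simp only [christoffel, hS, h1, ← mul_neg, ← Finset.sum_neg_distrib]
  congr 1
  refine Finset.sum_congr rfl fun s _ => ?_
  ring

theorem ricci_neg_of_even (hS : ∀ x, S (-x) = S x) (i j : Fin 3) (x : E3) :
    ricci S i j (-x) = ricci S i j x := by
  simp only [ricci, pderiv_neg_of_odd (christoffel_neg_of_even hS _ _ _),
    christoffel_neg_of_even hS, neg_mul_neg]

theorem scalarRemainder_neg_of_even (hS : ∀ x, S (-x) = S x) (x : E3) :
    scalarRemainder S (-x) = scalarRemainder S x := by
  have h1 : ∀ i j k l, pderiv l (pderiv k fun y => S y i j) (-x)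
      = pderiv l (pderiv k fun y => S y i j) x := fun i j k l =>
    pderiv_neg_of_odd fun y => pderiv_neg_of_even fun z => by rw [hS]
  simp only [scalarRemainder, scalarCurvature, volumeDensity, linearScalar, hS, h1,
    ricci_neg_of_even hS]

theorem fluxRemainder_neg_of_even (hS : ∀ x, S (-x) = S x) (α : Fin 3) (x : E3) :
    fluxRemainder S α (-x) = -fluxRemainder S α x := by
  have h1 : ∀ i j k, pderiv k (fun y => S y i j) (-x) = -pderiv k (fun y => S y i j) x :=
    fun i j k => pderiv_neg_of_even fun z => by rw [hS]
  have h2 : ∀ j, fluxField S α j (-x) = fluxField S α j x := fun j => by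
    simp only [fluxField, hS, h1, PiLp.neg_apply, Finset.sum_sub_distrib,
      Finset.sum_neg_distrib]
    ring
  simp only [fluxRemainder, h2, volumeDensity, hS, norm_neg, PiLp.neg_apply, neg_div, mul_neg,
    Finset.sum_neg_distrib]

end Parity

/-! ### The Schwarzschild metric -/

theorem pderiv_comp {u : E3 → ℝ} {φ : ℝ → ℝ} {φ' : ℝ} {x : E3} (i : Fin 3)
    (hφ : HasDerivAt φ φ' (u x)) (hu : DifferentiableAt ℝ u x) :
    pderiv i (fun y => φ (u y)) x = φ' * pderiv i u x := by
  have h := hφ.comp_hasFDerivAt x hu.hasFDerivAt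
  rw [pderiv, show (fun y => φ (u y)) = φ ∘ u from rfl, h.fderiv]
  simp [pderiv]

theorem contDiffAt_inv_norm {x : E3} (hx : x ≠ 0) : ContDiffAt ℝ ∞ (fun y : E3 => ‖y‖⁻¹) x :=
  (contDiffAt_norm ℝ hx).inv (norm_ne_zero_iff.2 hx)

theorem pderiv_inv_norm {x : E3} (hx : x ≠ 0) (i : Fin 3) :
    pderiv i (fun y : E3 => ‖y‖⁻¹) x = -(x i * ‖x‖⁻¹ ^ 3) := by
  have hn : ‖x‖ ≠ 0 := norm_ne_zero_iff.2 hx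
  have h := hasFDerivAt_norm_of_ne_zero hx
  rw [pderiv_comp (u := fun y : E3 => ‖y‖) i (hasDerivAt_inv hn) h.differentiableAt, pderiv,
    h.fderiv]
  simp [EuclideanSpace.inner_single_right]
  field_simp

/-- The conformal factor `(1 + m / (2 r))⁴` of the Schwarzschild metric. -/
noncomputable def schwarzschildFactor (m : ℝ) (x : E3) : ℝ :=
  (1 + m / 2 * ‖x‖⁻¹) ^ 4

theorem schwarzschild_apply (m : ℝ) (x : E3) (i j : Fin 3) :
    schwarzschild m x i j
      = (1 : Matrix (Fin 3) (Fin 3) ℝ) i j * schwarzschildFactor m x := by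
  rw [schwarzschild, schwarzschildFactor, Matrix.smul_apply, smul_eq_mul, mul_comm]
  congr 3
  rw [div_mul_eq_div_div, div_eq_mul_inv]

theorem schwarzschild_neg (m : ℝ) (x : E3) : schwarzschild m (-x) = schwarzschild m x := by
  simp [schwarzschild]

theorem contDiffAt_schwarzschildFactor (m : ℝ) {x : E3} (hx : x ≠ 0) :
    ContDiffAt ℝ ∞ (schwarzschildFactor m) x :=
  (contDiffAt_const.add (contDiffAt_const.mul (contDiffAt_inv_norm hx))).pow 4

theorem pderiv_schwarzschildFactor (m : ℝ) {x : E3} (hx : x ≠ 0) (i : Fin 3) :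
    pderiv i (schwarzschildFactor m) x
      = -(2 * m) * ((1 + m / 2 * ‖x‖⁻¹) ^ 3 * ‖x‖⁻¹ ^ 3 * x i) := by
  have h : HasDerivAt (fun s : ℝ => (1 + m / 2 * s) ^ 4)
      (2 * m * (1 + m / 2 * ‖x‖⁻¹) ^ 3) ‖x‖⁻¹ := by
    have h1 := (((hasDerivAt_id ‖x‖⁻¹).const_mul (m / 2)).const_add 1).pow 4
    refine h1.congr_deriv ?_
    simp
    ring
  have h2 := pderiv_comp (u := fun y : E3 => ‖y‖⁻¹) i h
    ((contDiffAt_inv_norm hx).differentiableAt (by simp))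
  rw [pderiv_inv_norm hx] at h2
  exact h2.trans (by ring)

theorem pderiv_pderiv_schwarzschildFactor (m : ℝ) {x : E3} (hx : x ≠ 0) (l k : Fin 3) :
    pderiv l (pderiv k (schwarzschildFactor m)) x
      = -(2 * m) * ((3 * (m / 2) * ((1 + m / 2 * ‖x‖⁻¹) ^ 2 * ‖x‖⁻¹ ^ 3)
          + 3 * ((1 + m / 2 * ‖x‖⁻¹) ^ 3 * ‖x‖⁻¹ ^ 2)) * (-(x l * ‖x‖⁻¹ ^ 3)) * x k
        + (1 + m / 2 * ‖x‖⁻¹) ^ 3 * ‖x‖⁻¹ ^ 3 * (1 : Matrix (Fin 3) (Fin 3) ℝ) l k) := by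
  have h : HasDerivAt (fun s : ℝ => (1 + m / 2 * s) ^ 3 * s ^ 3)
      (3 * (m / 2) * ((1 + m / 2 * ‖x‖⁻¹) ^ 2 * ‖x‖⁻¹ ^ 3)
          + 3 * ((1 + m / 2 * ‖x‖⁻¹) ^ 3 * ‖x‖⁻¹ ^ 2)) ‖x‖⁻¹ := by
    have h1 := ((((hasDerivAt_id ‖x‖⁻¹).const_mul (m / 2)).const_add 1).pow 3).mul
      ((hasDerivAt_id ‖x‖⁻¹).pow 3)
    refine h1.congr_deriv ?_
    simp
    ring
  have hu : DifferentiableAt ℝ (fun y : E3 => ‖y‖⁻¹) x :=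
    (contDiffAt_inv_norm hx).differentiableAt (by simp)
  have hφ : DifferentiableAt ℝ
      (fun y : E3 => (1 + m / 2 * ‖y‖⁻¹) ^ 3 * ‖y‖⁻¹ ^ 3) x :=
    h.differentiableAt.comp (f := fun y : E3 => ‖y‖⁻¹) x hu
  have hc : DifferentiableAt ℝ (fun y : E3 => y k) x :=
    (contDiff_coord k).differentiable (by simp) x
  have heq : pderiv k (schwarzschildFactor m) =ᶠ[𝓝 x] fun y =>
      -(2 * m) * ((1 + m / 2 * ‖y‖⁻¹) ^ 3 * ‖y‖⁻¹ ^ 3 * y k) := by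
    filter_upwards [isOpen_ne.mem_nhds hx] with y hy
    exact pderiv_schwarzschildFactor m hy k
  have hp : pderiv l (fun y : E3 => (1 + m / 2 * ‖y‖⁻¹) ^ 3 * ‖y‖⁻¹ ^ 3) x = _ :=
    pderiv_comp (u := fun y : E3 => ‖y‖⁻¹) l h hu
  rw [pderiv_congr heq, pderiv_const_mul _ (hφ.fun_mul hc), pderiv_mul hφ hc, hp,
    pderiv_inv_norm hx, pderiv_coord]

theorem isBigO_inv_norm_pow (n : ℕ) :
    (fun x : E3 => ‖x‖⁻¹ ^ n) =O[Bornology.cobounded E3] fun x => ‖x‖ ^ (-(n : ℤ)) := by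
  refine Asymptotics.isBigO_of_le _ fun x => ?_
  simp

theorem isBigO_coord (k : Fin 3) :
    (fun x : E3 => x k) =O[Bornology.cobounded E3] fun x => ‖x‖ ^ (1 : ℤ) :=
  Asymptotics.isBigO_of_le _ fun x => by simpa using PiLp.norm_apply_le x k

theorem agreesNearConst_const_mul_inv_norm (c : ℝ) :
    AgreesNearConst 0 (fun x : E3 => c * ‖x‖⁻¹) (fun x : E3 => c * ‖x‖⁻¹) :=
  AgreesToNextOrder.refl (by simpa using! (isBigO_inv_norm_pow 1).const_mul_left c)

theorem isBigO_one_add_pow (m : ℝ) (n : ℕ) :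
    (fun x : E3 => (1 + m / 2 * ‖x‖⁻¹) ^ n) =O[Bornology.cobounded E3] fun x => ‖x‖ ^ (0 : ℤ) :=
  ((agreesNearConst_const_mul_inv_norm (m / 2)).comp (φ := fun s => (1 + s) ^ n)
    (((hasStrictDerivAt_id (0 : ℝ)).const_add 1).pow n)).agrees.1

theorem isBigO_schwarzschildFactor_sub_one (m : ℝ) :
    (fun x => schwarzschildFactor m x - 1) =O[Bornology.cobounded E3] fun x => ‖x‖ ^ (-1 : ℤ) := by
  have := ((agreesNearConst_const_mul_inv_norm (m / 2)).comp (φ := fun s => (1 + s) ^ 4)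
    (((hasStrictDerivAt_id (0 : ℝ)).const_add 1).pow 4)).1
  simpa using! this

theorem isBigO_pderiv_schwarzschildFactor (m : ℝ) (k : Fin 3) :
    pderiv k (schwarzschildFactor m) =O[Bornology.cobounded E3] fun x => ‖x‖ ^ (-2 : ℤ) := by
  have h := (isBigO_mul_norm_zpow (isBigO_mul_norm_zpow (isBigO_one_add_pow m 3)
    (isBigO_inv_norm_pow 3)) (isBigO_coord k)).const_mul_left (-(2 * m))
  refine (h.trans (isBigO_norm_zpow_of_le (by norm_num))).congr' ?_ EventuallyEq.rfl
  filter_upwards [Bornology.eventually_ne_cobounded 0] with x hx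
  exact (pderiv_schwarzschildFactor m hx k).symm

theorem isBigO_pderiv_pderiv_schwarzschildFactor (m : ℝ) (l k : Fin 3) :
    pderiv l (pderiv k (schwarzschildFactor m)) =O[Bornology.cobounded E3]
      fun x => ‖x‖ ^ (-3 : ℤ) := by
  have h1 := ((isBigO_mul_norm_zpow (isBigO_one_add_pow m 2)
    (isBigO_inv_norm_pow 3)).const_mul_left (3 * (m / 2))).trans
      (isBigO_norm_zpow_of_le (b := -2) (by norm_num))
  have h2 := ((isBigO_mul_norm_zpow (isBigO_one_add_pow m 3)
    (isBigO_inv_norm_pow 2)).const_mul_left 3).trans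
      (isBigO_norm_zpow_of_le (b := -2) (by norm_num))
  have h3 := (isBigO_mul_norm_zpow (isBigO_mul_norm_zpow (h1.add h2)
    (isBigO_mul_norm_zpow (isBigO_coord l) (isBigO_inv_norm_pow 3)).neg_left)
      (isBigO_coord k)).trans (isBigO_norm_zpow_of_le (b := -3) (by norm_num))
  have h4 := ((isBigO_mul_norm_zpow (isBigO_one_add_pow m 3) (isBigO_inv_norm_pow 3)).const_mul_left
    ((1 : Matrix (Fin 3) (Fin 3) ℝ) l k)).trans
      (isBigO_norm_zpow_of_le (b := -3) (by norm_num))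
  refine ((h3.add h4).const_mul_left (-(2 * m))).congr' ?_ EventuallyEq.rfl
  filter_upwards [Bornology.eventually_ne_cobounded 0] with x hx
  rw [pderiv_pderiv_schwarzschildFactor m hx, mul_comm ((1 : Matrix (Fin 3) (Fin 3) ℝ) l k)]

section Decay

variable {p : E3 → ℝ} {a : ℤ}

theorem IsBigOWithDerivs.isBigO_iteratedFDeriv {n i : ℕ} (h : IsBigOWithDerivs n a p)
    (hi : i ≤ n) :
    (fun x => ‖iteratedFDeriv ℝ i p x‖) =O[Bornology.cobounded E3]
      fun x => ‖x‖ ^ (a - (i : ℤ)) := by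
  obtain ⟨R, C, -, hC⟩ := h
  refine Asymptotics.IsBigO.of_bound C ?_
  filter_upwards [tendsto_norm_cobounded_atTop.eventually_ge_atTop R] with x hx
  rw [norm_norm, Real.norm_of_nonneg (by positivity)]
  exact hC i hi x hx

theorem norm_pderiv_le (i : Fin 3) (u : E3 → ℝ) (x : E3) :
    ‖pderiv i u x‖ ≤ ‖fderiv ℝ u x‖ := by
  simpa [pderiv] using (fderiv ℝ u x).le_opNorm (EuclideanSpace.single i 1)

theorem norm_pderiv_pderiv_le {x : E3} (hp : ContDiffAt ℝ ∞ p x) (l k : Fin 3) :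
    ‖pderiv l (pderiv k p) x‖ ≤ ‖iteratedFDeriv ℝ 2 p x‖ := by
  have hd : DifferentiableAt ℝ (fderiv ℝ p) x :=
    (hp.fderiv_right (m := ∞) (by simp)).differentiableAt (by simp)
  have h1 : pderiv l (pderiv k p) x
      = iteratedFDeriv ℝ 2 p x ![EuclideanSpace.single l 1, EuclideanSpace.single k 1] := by
    rw [iteratedFDeriv_two_apply, pderiv]
    have : pderiv k p = fun y => fderiv ℝ p y (EuclideanSpace.single k 1) := rfl
    rw [this, fderiv_clm_apply hd (differentiableAt_const _)]
    simp
  rw [h1]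
  refine ((iteratedFDeriv ℝ 2 p x).le_opNorm _).trans ?_
  simp [Fin.prod_univ_two]

end Decay

/-- An asymptotically Schwarzschild metric agrees to next order with the Schwarzschild metric. -/
theorem IsAsymptoticallySchwarzschild.metricsAgree {g : MatrixField} {m : ℝ}
    (hg : IsAsymptoticallySchwarzschild g m) : MetricsAgree g (schwarzschild m) := by
  have hne := Bornology.eventually_ne_cobounded (0 : E3)
  have hgs : ∀ i j x, ContDiffAt ℝ ∞ (fun y => g y i j) x := fun i j x =>
    (hg.metric.smooth i j).contDiffAt
  have hSeq : ∀ i j, (fun y => schwarzschild m y i j)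
      = fun y => (1 : Matrix (Fin 3) (Fin 3) ℝ) i j * schwarzschildFactor m y := fun i j =>
    funext fun y => schwarzschild_apply m y i j
  have hSs : ∀ i j x, x ≠ 0 → ContDiffAt ℝ ∞ (fun y => schwarzschild m y i j) x :=
    fun i j x hx => by
      rw [hSeq]
      exact contDiffAt_const.mul (contDiffAt_schwarzschildFactor m hx)
  have hFd : ∀ x : E3, x ≠ 0 → DifferentiableAt ℝ (schwarzschildFactor m) x := fun x hx =>
    (contDiffAt_schwarzschildFactor m hx).differentiableAt (by simp)
  have hS1 : ∀ k i j x, x ≠ 0 → pderiv k (fun y => schwarzschild m y i j) x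
      = (1 : Matrix (Fin 3) (Fin 3) ℝ) i j * pderiv k (schwarzschildFactor m) x :=
    fun k i j x hx => by rw [hSeq, pderiv_const_mul _ (hFd x hx)]
  have hp1 : ∀ k i j x, x ≠ 0 →
      pderiv k (fun y => g y i j - schwarzschild m y i j) x
        = pderiv k (fun y => g y i j) x - pderiv k (fun y => schwarzschild m y i j) x :=
    fun k i j x hx => pderiv_sub ((hgs i j x).differentiableAt (by simp))
      ((hSs i j x hx).differentiableAt (by simp))
  refine ⟨.of_forall fun x i j => hgs i j x, hne.mono fun x hx i j => hSs i j x hx,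
    fun x i j => by simpa using ((hg.metric.posDef x).isHermitian.apply j i), fun x i j => ?_,
    fun i j => ?_, fun k i j => ?_, fun l k i j => ?_⟩
  · rw [schwarzschild_apply, schwarzschild_apply, Matrix.one_apply, Matrix.one_apply]
    simp only [eq_comm]
  · refine AgreesToNextOrder.of_right ?_ ?_
    · refine ((isBigO_schwarzschildFactor_sub_one m).const_mul_left
        ((1 : Matrix (Fin 3) (Fin 3) ℝ) i j)).congr_left fun x => ?_
      simp only [schwarzschild_apply]
      ring
    · have h := (hg.decay i j).isBigO_iteratedFDeriv (i := 0) (by norm_num)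
      simp only [norm_iteratedFDeriv_zero, Asymptotics.isBigO_norm_left] at h
      exact h.congr_left fun x => by ring
  · refine AgreesToNextOrder.of_right ?_ ?_
    · refine ((isBigO_pderiv_schwarzschildFactor m k).const_mul_left
        ((1 : Matrix (Fin 3) (Fin 3) ℝ) i j)).congr' ?_ EventuallyEq.rfl
      exact hne.mono fun x hx => (hS1 k i j x hx).symm
    · have h := (hg.decay i j).isBigO_iteratedFDeriv (i := 1) (by norm_num)
      have h1 : pderiv k (fun y => g y i j - schwarzschild m y i j) =O[Bornology.cobounded E3]
          fun x => ‖x‖ ^ (-2 - 1 : ℤ) :=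
        (Asymptotics.isBigO_of_le _ fun x => by
          simpa only [norm_norm, norm_iteratedFDeriv_one] using norm_pderiv_le k _ x).trans h
      exact h1.congr' (hne.mono fun x hx => hp1 k i j x hx) EventuallyEq.rfl
  · have hnhds : ∀ x : E3, x ≠ 0 → ∀ᶠ y in 𝓝 x, y ≠ 0 := fun x hx => isOpen_ne.mem_nhds hx
    refine AgreesToNextOrder.of_right ?_ ?_
    · refine ((isBigO_pderiv_pderiv_schwarzschildFactor m l k).const_mul_left
        ((1 : Matrix (Fin 3) (Fin 3) ℝ) i j)).congr' ?_ EventuallyEq.rfl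
      refine hne.mono fun x hx => ?_
      rw [pderiv_congr ((hnhds x hx).mono fun y hy => hS1 k i j y hy),
        pderiv_const_mul _ ((contDiffAt_pderiv
          (contDiffAt_schwarzschildFactor m hx)).differentiableAt (by simp))]
    · have h := (hg.decay i j).isBigO_iteratedFDeriv (i := 2) (by norm_num)
      have h1 : pderiv l (pderiv k (fun y => g y i j - schwarzschild m y i j))
          =O[Bornology.cobounded E3] fun x => ‖x‖ ^ (-3 - 1 : ℤ) := by
        refine Asymptotics.IsBigO.trans (Asymptotics.IsBigO.of_bound 1 ?_) h
        refine hne.mono fun x hx => ?_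
        rw [norm_norm, one_mul]
        exact norm_pderiv_pderiv_le ((hgs i j x).sub (hSs i j x hx)) l k
      refine h1.congr' (hne.mono fun x hx => ?_) EventuallyEq.rfl
      rw [pderiv_congr ((hnhds x hx).mono fun y hy => hp1 k i j y hy),
        pderiv_sub ((contDiffAt_pderiv (hgs i j x)).differentiableAt (by simp))
          ((contDiffAt_pderiv (hSs i j x hx)).differentiableAt (by simp))]

/-! ### Convergence of the nonlinear terms -/

theorem integrableOn_ball_of_continuous {f : E3 → ℝ} (hf : Continuous f) (r : ℝ) :
    IntegrableOn f (Metric.ball (0 : E3) r) :=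
  (hf.locallyIntegrable.integrableOn_isCompact (isCompact_closedBall 0 r)).mono_set
    Metric.ball_subset_closedBall

/-- The integral over a ball only sees the even part of the integrand. -/
theorem integral_ball_eq_even_part {f : E3 → ℝ} (hf : Continuous f) (r : ℝ) :
    ∫ x in Metric.ball (0 : E3) r, f x
      = ∫ x in Metric.ball (0 : E3) r, (f x + f (-x)) / 2 := by
  have h1 : ∫ x in Metric.ball (0 : E3) r, f (-x) = ∫ x in Metric.ball (0 : E3) r, f x := by
    have h2 := (Measure.measurePreserving_neg (volume : Measure E3)).setIntegral_preimage_emb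
      (Homeomorph.neg E3).measurableEmbedding f (Metric.ball (0 : E3) r)
    have h3 : (Neg.neg : E3 → E3) ⁻¹' Metric.ball (0 : E3) r = Metric.ball (0 : E3) r := by
      ext x
      simp
    rwa [h3] at h2
  have hneg : Continuous fun x => f (-x) := hf.comp continuous_neg
  rw [integral_div, integral_add (integrableOn_ball_of_continuous hf r)
    (integrableOn_ball_of_continuous hneg r), h1]
  ring

theorem tendsto_neg_cobounded_E3 :
    Tendsto (fun x : E3 => -x) (Bornology.cobounded E3) (Bornology.cobounded E3) := by
  rw [← tendsto_norm_atTop_iff_cobounded]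
  simpa using tendsto_norm_cobounded_atTop (E := E3)

theorem integrable_of_isBigO_norm_zpow {f : E3 → ℝ} (hf : Continuous f)
    (h : f =O[Bornology.cobounded E3] fun x => ‖x‖ ^ (-4 : ℤ)) : Integrable f := by
  rw [Metric.cobounded_eq_cocompact] at h
  have hint : Integrable fun x : E3 => (1 + ‖x‖) ^ (-4 : ℝ) :=
    integrable_one_add_norm (by simp; norm_num)
  refine hf.locallyIntegrable.integrable_of_isBigO_cocompact (h.trans ?_)
    (hint.integrableAtFilter _)
  rw [← Metric.cobounded_eq_cocompact]
  refine Asymptotics.IsBigO.of_bound 16 ?_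
  filter_upwards [eventually_one_le_norm] with x hx
  have h0 : (0 : ℝ) < ‖x‖ := by linarith
  rw [Real.norm_of_nonneg (by positivity), Real.norm_of_nonneg (by positivity),
    show (-4 : ℝ) = ((-4 : ℤ) : ℝ) by norm_num, Real.rpow_intCast]
  calc ‖x‖ ^ (-4 : ℤ) = 16 * (2 * ‖x‖) ^ (-4 : ℤ) := by rw [mul_zpow]; norm_num; ring
    _ ≤ 16 * (1 + ‖x‖) ^ (-4 : ℤ) := by
      simp only [zpow_neg]
      gcongr 16 * ?_⁻¹
      exact zpow_le_zpow_left₀ (by norm_num) (by positivity) (by linarith)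

theorem IsRiemannianMetric.isRegularAt {g : MatrixField} (hg : IsRiemannianMetric g) (x : E3) :
    IsRegularAt g x :=
  ⟨fun i j => (hg.smooth i j).contDiffAt, (hg.posDef x).det_pos.ne'⟩

theorem IsRiemannianMetric.symm {g : MatrixField} (hg : IsRiemannianMetric g) (x : E3)
    (i j : Fin 3) : g x i j = g x j i := by
  simpa using (hg.posDef x).isHermitian.apply j i

theorem IsRiemannianMetric.continuous_volumeDensity {g : MatrixField}
    (hg : IsRiemannianMetric g) : Continuous (volumeDensity g) :=
  Real.continuous_sqrt.comp (continuous_iff_continuousAt.2 fun x =>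
    (contDiffAt_det (k := ∞) (hg.isRegularAt x).1).continuousAt)

theorem IsRiemannianMetric.continuous_scalarCurvature {g : MatrixField}
    (hg : IsRiemannianMetric g) : Continuous (scalarCurvature g) :=
  continuous_iff_continuousAt.2 fun x =>
    (hg.isRegularAt x).contDiffAt_scalarCurvature.continuousAt

theorem IsRiemannianMetric.continuous_linearScalar {g : MatrixField}
    (hg : IsRiemannianMetric g) : Continuous (linearScalar g) := by
  have h : ∀ i j k l, Continuous (pderiv l (pderiv k fun y => g y i j)) := fun i j k l =>
    (contDiff_pderiv (contDiff_pderiv (hg.smooth i j) k) l).continuous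
  unfold linearScalar
  fun_prop

/-- The nonlinear part of the curvature moment converges: the integrand of the Schwarzschild metric
is odd, so the even part of the integrand of `g` is that of the difference of the two, which is
`O(r⁻⁴)` and hence integrable. -/
theorem exists_tendsto_integral_scalarRemainder {g : MatrixField} {m : ℝ}
    (hg : IsAsymptoticallySchwarzschild g m) (α : Fin 3) :
    ∃ L : ℝ, Tendsto (fun r : ℝ => ∫ x in Metric.ball (0 : E3) r, x α * scalarRemainder g x)
      atTop (𝓝 L) := by
  have hWc : Continuous (scalarRemainder g) :=
    (hg.metric.continuous_scalarCurvature.mul hg.metric.continuous_volumeDensity).sub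
      hg.metric.continuous_linearScalar
  have hxc := (contDiff_coord α).continuous
  have hfc : Continuous fun x : E3 => x α * scalarRemainder g x := hxc.mul hWc
  set e : E3 → ℝ := fun x =>
    (x α * scalarRemainder g x + (-x) α * scalarRemainder g (-x)) / 2 with he
  have hec : Continuous e := (hfc.add (hfc.comp continuous_neg)).div_const 2
  have hdiff := hg.metricsAgree.scalarRemainder_agrees.2
  have hdiff' : (fun x => scalarRemainder g (-x) - scalarRemainder (schwarzschild m) (-x))
      =O[Bornology.cobounded E3] fun x => ‖x‖ ^ (-4 - 1 : ℤ) := by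
    simpa [Function.comp_def] using hdiff.comp_tendsto tendsto_neg_cobounded_E3
  have heO : e =O[Bornology.cobounded E3] fun x => ‖x‖ ^ (-4 : ℤ) := by
    have h1 := (isBigO_mul_norm_zpow (isBigO_coord α) (hdiff.sub hdiff')).const_mul_left (1 / 2)
    refine h1.congr_left fun x => ?_
    rw [scalarRemainder_neg_of_even (schwarzschild_neg m), he]
    simp only [PiLp.neg_apply]
    ring
  refine ⟨∫ x, e x, ?_⟩
  have hlim := (aecover_ball (μ := (volume : Measure E3)) (x := (0 : E3))
    tendsto_id).integral_tendsto_of_countably_generated (integrable_of_isBigO_norm_zpow hec heO)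
  refine hlim.congr fun r => ?_
  exact (integral_ball_eq_even_part hfc r).symm

theorem continuousOn_fluxRemainder {g : MatrixField} (hg : IsRiemannianMetric g) (α : Fin 3) :
    ContinuousOn (fluxRemainder g α) {0}ᶜ := by
  have h1 : ∀ j, ContinuousOn (fluxField g α j) {0}ᶜ := fun j =>
    (contDiff_fluxField hg.smooth α j).continuous.continuousOn
  have h2 : ContinuousOn (volumeDensity g) {0}ᶜ := hg.continuous_volumeDensity.continuousOn
  have h3 : ∀ i j, ContinuousOn (fun x => (g x)⁻¹ i j) {0}ᶜ := fun i j x _ =>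
    ((hg.isRegularAt x).contDiffAt_inv i j).continuousAt.continuousWithinAt
  have h4 : ∀ k, ContinuousOn (fun x : E3 => x k / ‖x‖) {0}ᶜ := fun k =>
    (contDiff_coord k).continuous.continuousOn.div continuous_norm.continuousOn fun x hx =>
      norm_ne_zero_iff.2 hx
  exact continuousOn_finsetSum _ fun j _ => (h1 j).mul (continuousOn_finsetSum _ fun k _ =>
    ((h2.mul (h3 j k)).sub continuousOn_const).mul (h4 k))

/-- The nonlinear part of the flux tends to zero: the density of the Schwarzschild metric is odd, so
the even part of the density of `g` is that of the difference of the two, which is `O(r⁻³)`, while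
spheres have area `O(r²)`. -/
theorem tendsto_sphereIntegral_fluxRemainder {g : MatrixField} {m : ℝ}
    (hg : IsAsymptoticallySchwarzschild g m) (α : Fin 3) :
    Tendsto (sphereIntegral (fluxRemainder g α)) atTop (𝓝 0) := by
  have hdiff := (hg.metricsAgree.fluxRemainder_agrees α).2
  have hdiff' : (fun x => fluxRemainder g α (-x) - fluxRemainder (schwarzschild m) α (-x))
      =O[Bornology.cobounded E3] fun x => ‖x‖ ^ (-2 - 1 : ℤ) := by
    simpa [Function.comp_def] using hdiff.comp_tendsto tendsto_neg_cobounded_E3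
  have heO : (fun x => (fluxRemainder g α x + fluxRemainder g α (-x)) / 2)
      =O[Bornology.cobounded E3] fun x => ‖x‖ ^ (-2 - 1 : ℤ) := by
    refine ((hdiff.add hdiff').const_mul_left (1 / 2)).congr_left fun x => ?_
    rw [fluxRemainder_neg_of_even (schwarzschild_neg m)]
    ring
  obtain ⟨C, hC⟩ := heO.bound
  rw [← comap_norm_atTop, eventually_comap] at hC
  set A := (volume : Measure E3).toSphere.real Set.univ
  have hlim : Tendsto (fun r : ℝ => C * A * r⁻¹) atTop (𝓝 0) := by
    simpa using tendsto_inv_atTop_zero.const_mul (C * A)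
  refine squeeze_zero_norm' ?_ hlim
  filter_upwards [hC, eventually_gt_atTop 0] with r hCr hr
  rw [Real.norm_eq_abs, sphereIntegral_eq_even_part (continuousOn_fluxRemainder hg.metric α) hr]
  refine (abs_sphereIntegral_le (C := C * r ^ (-2 - 1 : ℤ)) hr fun x hx => ?_).trans_eq ?_
  · have h := hCr x hx
    rwa [hx, Real.norm_eq_abs, Real.norm_of_nonneg (by positivity)] at h
  · have : r ^ (-2 - 1 : ℤ) = (r ^ 3)⁻¹ := by
      rw [show (-2 - 1 : ℤ) = -((3 : ℕ) : ℤ) by norm_num, zpow_neg, zpow_natCast]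
    rw [this]
    field_simp
    rfl

/-! ### The center of mass and the curvature moments -/

theorem csCenter_apply {g : MatrixField} (hg : IsRiemannianMetric g) (m : ℝ) (α : Fin 3) {r : ℝ}
    (hr : 0 < r) :
    csCenter g m r α = 1 / (16 * Real.pi * m) *
      (sphereIntegral (fun x => ∑ j, fluxField g α j x * (x j / ‖x‖)) r
        + sphereIntegral (fluxRemainder g α) r) := by
  have h1 : ContinuousOn (fun x => ∑ j, fluxField g α j x * (x j / ‖x‖)) {0}ᶜ :=
    continuousOn_finsetSum _ fun j _ =>
      (contDiff_fluxField hg.smooth α j).continuous.continuousOn.mul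
        ((contDiff_coord j).continuous.continuousOn.div continuous_norm.continuousOn fun x hx =>
          norm_ne_zero_iff.2 hx)
  rw [← sphereIntegral_add h1 (continuousOn_fluxRemainder hg α) hr]
  simp only [csCenter]
  congr 1
  refine sphereIntegral_congr hr fun x hx => ?_
  have hx0 : x ≠ 0 := by
    rintro rfl
    simp at hx
    exact hr.ne hx
  exact csIntegrand_mul_areaDensity hg hg.symm α hx0

/-- The linear part of the curvature moment is the flux, by the divergence theorem. -/
theorem curvatureMoment_eq {g : MatrixField} (hg : IsRiemannianMetric g) (α : Fin 3) {r : ℝ}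
    (hr : 0 < r) :
    curvatureMoment g α r
      = sphereIntegral (fun x => ∑ j, fluxField g α j x * (x j / ‖x‖)) r
        + ∫ x in Metric.ball (0 : E3) r, x α * scalarRemainder g x := by
  have hlin : Continuous fun x : E3 => x α * linearScalar g x :=
    (contDiff_coord α).continuous.mul hg.continuous_linearScalar
  have hrem : Continuous fun x : E3 => x α * scalarRemainder g x :=
    (contDiff_coord α).continuous.mul ((hg.continuous_scalarCurvature.mul
      hg.continuous_volumeDensity).sub hg.continuous_linearScalar)
  have hdiv := integral_ball_div (fun j => (contDiff_fluxField hg.smooth α j).of_le (by simp)) hr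
  simp only [sum_pderiv_fluxField hg.smooth hg.symm] at hdiv
  rw [← hdiv, ← integral_add (integrableOn_ball_of_continuous hlin r)
    (integrableOn_ball_of_continuous hrem r), curvatureMoment]
  congr 1
  funext x
  rw [scalarRemainder]
  ring

theorem csCenterExists_iff (g : MatrixField) (m : ℝ) :
    CSCenterExists g m ↔
      ∀ α : Fin 3, ∃ L : ℝ, Tendsto (fun r : ℝ => csCenter g m r α) atTop (𝓝 L) := by
  constructor
  · rintro ⟨c, hc⟩ α
    exact ⟨c α, ((contDiff_coord α).continuous.tendsto c).comp hc⟩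
  · intro h
    choose L hL using h
    refine ⟨WithLp.toLp 2 L, ?_⟩
    exact ((PiLp.continuous_toLp 2 fun _ : Fin 3 => ℝ).tendsto L).comp (tendsto_pi_nhds.2 hL)

end AsymSchwarzschild

theorem mainTheorem3 (g : AsymSchwarzschild.MatrixField) (m : ℝ)
    (hg : AsymSchwarzschild.IsAsymptoticallySchwarzschild g m) :
    AsymSchwarzschild.CSCenterExists g m ↔
      ∀ α : Fin 3, ∃ L : ℝ,
        Tendsto (fun r : ℝ => AsymSchwarzschild.curvatureMoment g α r) atTop (𝓝 L) := by
  rw [AsymSchwarzschild.csCenterExists_iff]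
  refine forall_congr' fun α => ?_
  obtain ⟨M, hM⟩ := AsymSchwarzschild.exists_tendsto_integral_scalarRemainder hg α
  have hQ := AsymSchwarzschild.tendsto_sphereIntegral_fluxRemainder hg α
  have hk : 16 * Real.pi * m ≠ 0 := by have := hg.mass_pos; positivity
  constructor
  · rintro ⟨L, hL⟩
    refine ⟨16 * Real.pi * m * L - 0 + M, (((hL.const_mul _).sub hQ).add hM).congr' ?_⟩
    filter_upwards [eventually_gt_atTop 0] with r hr
    rw [AsymSchwarzschild.csCenter_apply hg.metric m α hr,
      AsymSchwarzschild.curvatureMoment_eq hg.metric α hr]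
    rw [← mul_assoc, mul_one_div_cancel hk]
    ring
  · rintro ⟨L, hL⟩
    refine ⟨1 / (16 * Real.pi * m) * (L - M + 0), (((hL.sub hM).add hQ).const_mul _).congr' ?_⟩
    filter_upwards [eventually_gt_atTop 0] with r hr
    rw [AsymSchwarzschild.csCenter_apply hg.metric m α hr,
      AsymSchwarzschild.curvatureMoment_eq hg.metric α hr]
    ring
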